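/- Let $G=*_{n\ge 1}\mathbb{Z}^n$ be the free product of the groups $\mathbb{Z}^n$, $n\ge1$, and let $a_{1,n},\dots,a_{n,n}$ denote the standard generators of $\mathbb{Z}^n$. Let $f:\mathbb{N}\to\mathbb{N}$ be strictly increasing on $\{1,2,\dots\}$ with $f(1)=1$, and suppose that $f^{-1}(N)=o\left(\frac{N}{\ln N}\right)$ as $N\to\infty$, where $f^{-1}(N)$ denotes the largest $n\ge1$ with $f(n)\le N$. Let $l$ be the length on $G$ in which each $a_{i,n}$ has length $f(n)$: an element $v=(v_1,\dots,v_n)\in\mathbb{Z}^n$ has $l(v)=f(n)\sum_i|v_i|$, and the length of a reduced word is the sum of the lengths of its syllables. Terminology. A length function on a group $\Gamma$ is a function $\ell:\Gamma\to\mathbb{R}_{\ge0}$ with $\ell(e)=0$, $\ell(g^{-1})=\ell(g)$ and $\ell(gh)\le\ell(g)+\ell(h)$ for all $g,h$. A function $d:\mathbb{N}\to\mathbb{R}$ is a decay function for $(\Gamma,\ell)$ if $\|x\|\le d(D)\|x\|_2$ for all $D\in\mathbb{N}$ and all $x\in\mathbb{C}[\Gamma]$ supported on $\{g:\ell(g)\le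 D\}$, where $\|x\|$ is the operator norm of $x$ acting on $\ell^2(\Gamma)$ by the left regular representation and $\|x\|_2=\left(\sum_g|x(g)|^2\right)^{1/2}$. The group $\Gamma$ has property SD with respect to a length function $\ell$ if $(\Gamma,\ell)$ has a decay function $d:\mathbb{N}\to\mathbb{R}_{\ge0}$ with $\lim_{n\to\infty} d(n)^{1/n}=1$; it has property RD with respect to $\ell$ if $(\Gamma,\ell)$ has a polynomial decay function. Then $l$ is a length function and $G$ has SD with respect to $l$, but $G$ has RD with respect to no length function. Moreover, every amenable subgroup of $G$ has polynomial growth; that is, it is finitely generated and, for each of its finite generating sets, the number of elements of word length at most $n$ is bounded by a polynomial in $n$. -/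

import Mathlib

open Filter Topology Asymptotics
open scoped ENNReal

noncomputable section

namespace GroupDecay

/-! ### Length functions and decay -/

/-- A length function on a group: it vanishes at the identity, is symmetric and subadditive, and
takes values in the nonnegative reals. -/
structure IsLengthFunction {G : Type*} [Group G] (l : G → ℝ) : Prop where
  nonneg : ∀ g, 0 ≤ l g
  map_one : l 1 = 0
  map_inv : ∀ g, l g⁻¹ = l g
  map_mul_le : ∀ g h, l (g * h) ≤ l g + l h

/-- The Hilbert space `ℓ²(G)`. -/
abbrev EllTwo (G : Type*) : Type _ := lp (fun _ : G => ℂ) 2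

lemma memℓp_leftTranslate {G : Type*} [Group G] (g : G) (ξ : EllTwo G) :
    Memℓp (fun h : G => ξ (g⁻¹ * h)) 2 := by
  have hp : 0 < (2 : ℝ≥0∞).toReal := by norm_num
  have h := (memℓp_gen_iff hp).1 (lp.memℓp ξ)
  exact (memℓp_gen_iff hp).2 ((Equiv.mulLeft g⁻¹).summable_iff.2 h)

/-- Left translation by `g` on `ℓ²(G)`: `(λ(g) ξ)(h) = ξ(g⁻¹ h)`. -/
def leftTranslate {G : Type*} [Group G] (g : G) : EllTwo G →ₗᵢ[ℂ] EllTwo G where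
  toFun ξ := ⟨fun h => ξ (g⁻¹ * h), memℓp_leftTranslate g ξ⟩
  map_add' _ _ := rfl
  map_smul' _ _ := rfl
  norm_map' ξ := by
    have hp : 0 < (2 : ℝ≥0∞).toReal := by norm_num
    rw [lp.norm_eq_tsum_rpow hp, lp.norm_eq_tsum_rpow hp]
    congr 1
    exact (Equiv.mulLeft g⁻¹).tsum_eq fun h : G => ‖ξ h‖ ^ (2 : ℝ≥0∞).toReal

lemma leftTranslate_apply {G : Type*} [Group G] (g : G) (ξ : EllTwo G) (h : G) :
    leftTranslate g ξ h = ξ (g⁻¹ * h) := rfl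

/-- The left regular representation `λ` of `G` on `ℓ²(G)`. -/
def leftRegular (G : Type*) [Group G] : G →* (EllTwo G →L[ℂ] EllTwo G) where
  toFun g := (leftTranslate g).toContinuousLinearMap
  map_one' := by
    ext ξ h
    simp [leftTranslate_apply]
  map_mul' a b := by
    ext ξ h
    simp [leftTranslate_apply, mul_assoc]

/-- The operator norm of an element of `ℂ[G]`, acting on `ℓ²(G)` by the left regular
representation (extended linearly from `G` to `ℂ[G]`). -/
def regularNorm {G : Type*} [Group G] (x : MonoidAlgebra ℂ G) : ℝ :=
  ‖MonoidAlgebra.lift ℂ (EllTwo G →L[ℂ] EllTwo G) G (leftRegular G) x‖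

/-- The `2`-norm `(∑ |x(g)|²)^{1/2}` of an element of `ℂ[G]`. -/
def twoNorm {G : Type*} [Group G] (x : MonoidAlgebra ℂ G) : ℝ :=
  Real.sqrt (∑ g ∈ x.coeff.support, ‖x.coeff g‖ ^ 2)

/-- `d` is a decay function for `(G, l)`: `‖x‖ ≤ d(n) ‖x‖₂` for every `x ∈ ℂ[G]` supported on the
closed `l`-ball of radius `n` around the identity. -/
def IsDecayFunction {G : Type*} [Group G] (l : G → ℝ) (d : ℕ → ℝ) : Prop :=
  ∀ (n : ℕ) (x : MonoidAlgebra ℂ G), (∀ g ∈ x.coeff.support, l g ≤ n) →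
    regularNorm x ≤ d n * twoNorm x

/-- A function `d : ℕ → ℝ_{≥ 0}` is subexponential if `d(n)^{1/n} → 1`. -/
def IsSubexponential (d : ℕ → ℝ) : Prop :=
  (∀ n, 0 ≤ d n) ∧ Tendsto (fun n : ℕ => d n ^ (1 / (n : ℝ))) atTop (𝓝 1)

/-- `l` is a length function, and `G` has property SD (subexponential decay) with respect to it. -/
def HasSDWithRespectTo {G : Type*} [Group G] (l : G → ℝ) : Prop :=
  IsLengthFunction l ∧ ∃ d : ℕ → ℝ, IsSubexponential d ∧ IsDecayFunction l d

/-- `l` is a length function, and `G` has property RD (rapid decay) with respect to it: some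
polynomial is a decay function for `(G, l)`. -/
def HasRDWithRespectTo {G : Type*} [Group G] (l : G → ℝ) : Prop :=
  IsLengthFunction l ∧ ∃ P : Polynomial ℝ, IsDecayFunction l fun n => P.eval (n : ℝ)

/-- `G` has property RD: it has RD with respect to some length function. -/
def HasRD (G : Type*) [Group G] : Prop :=
  ∃ l : G → ℝ, HasRDWithRespectTo l

/-! ### Amenability and growth -/

/-- A (discrete) group is amenable if it carries a left-invariant finitely additive probability
measure, defined on all subsets. -/
def IsAmenable (H : Type*) [Group H] : Prop :=
  ∃ m : Set H → ℝ, (∀ A, 0 ≤ m A) ∧ m Set.univ = 1 ∧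
    (∀ A B, Disjoint A B → m (A ∪ B) = m A + m B) ∧
    ∀ (h : H) (A : Set H), m ((fun x => h * x) '' A) = m A

/-- The ball of radius `n` for the word length of a subset `S` of a group: the products of at most
`n` elements of `S ∪ S⁻¹`. -/
def wordBall {H : Type*} [Group H] (S : Set H) (n : ℕ) : Set H :=
  {g | ∃ w : List H, w.length ≤ n ∧ (∀ s ∈ w, s ∈ S ∨ s⁻¹ ∈ S) ∧ w.prod = g}

/-- A group has polynomial growth if it is finitely generated and, for every finite generating set,
the cardinality of the ball of radius `n` is bounded by a polynomial in `n`. -/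
def HasPolynomialGrowth (H : Type*) [Group H] : Prop :=
  Group.FG H ∧ ∀ S : Set H, S.Finite → Subgroup.closure S = ⊤ →
    ∃ C k : ℕ, ∀ n : ℕ, (wordBall S n).ncard ≤ C * (n + 1) ^ k

/-! ### The free product of the groups `ℤⁿ`, `n ≥ 1` -/

/-- The group `ℤⁿ`, written multiplicatively. -/
abbrev ZPow (n : ℕ+) : Type := Multiplicative (Fin (n : ℕ) → ℤ)

/-- The free product of the groups `ℤⁿ` over all `n ≥ 1`. -/
abbrev FreeProdZ : Type := Monoid.CoprodI ZPow

/-- The standard generator `a_{i,n}` of the free factor `ℤⁿ`. -/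
def stdGen (n : ℕ+) (i : Fin (n : ℕ)) : FreeProdZ :=
  Monoid.CoprodI.of (M := ZPow) (i := n) (Multiplicative.ofAdd (Pi.single i 1))

/-- The length of an element of `ℤⁿ` when each standard generator is given length `f n`:
`f(n) (|v₁| + ⋯ + |vₙ|)`. -/
def syllableLength (f : ℕ → ℕ) (s : Σ n : ℕ+, ZPow n) : ℕ :=
  f s.1 * ∑ i, (Multiplicative.toAdd s.2 i).natAbs

/-- The length function on the free product for which each standard generator of `ℤⁿ` has length
`f n`: the length of a reduced word is the sum of the lengths of its syllables. -/
def freeProdLength (f : ℕ → ℕ) (g : FreeProdZ) : ℝ :=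
  (((Monoid.CoprodI.Word.equiv g).toList.map (syllableLength f)).sum : ℕ)

lemma freeProdLength_stdGen (f : ℕ → ℕ) (n : ℕ+) (i : Fin (n : ℕ)) :
    freeProdLength f (stdGen n i) = f n := by
  have hne : (Multiplicative.ofAdd (Pi.single i 1) : ZPow n) ≠ 1 := by
    intro h
    have h' := congrFun (congrArg Multiplicative.toAdd h) i
    simp at h'
  have hidx : (Monoid.CoprodI.Word.empty : Monoid.CoprodI.Word ZPow).fstIdx ≠ some n := by
    intro h
    cases h
  have hw : Monoid.CoprodI.Word.equiv (stdGen n i) =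
      Monoid.CoprodI.Word.cons (M := ZPow) (i := n) (Multiplicative.ofAdd (Pi.single i 1))
        Monoid.CoprodI.Word.empty hidx hne := by
    apply Monoid.CoprodI.Word.equiv.symm.injective
    rw [Equiv.symm_apply_apply]
    refine Eq.trans ?_ (Monoid.CoprodI.Word.prod_cons n _ _ hne hidx).symm
    simp [stdGen]
  have hsum : ∑ j, ((Pi.single i 1 : Fin (n : ℕ) → ℤ) j).natAbs = 1 := by
    rw [Finset.sum_eq_single i]
    · simp
    · intro j _ hj
      simp [hj]
    · simp
  rw [freeProdLength, hw]
  simp [Monoid.CoprodI.Word.cons, Monoid.CoprodI.Word.empty, syllableLength, hsum]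

/-- The inverse `f⁻¹(N)` of a strictly increasing function `f` on `{1, 2, …}`: the largest `n ≥ 1`
with `f n ≤ N`. -/
def floorInverse (f : ℕ → ℕ) (N : ℕ) : ℕ :=
  sSup {n : ℕ | 1 ≤ n ∧ f n ≤ N}

end GroupDecay

end

open GroupDecay

/-!
For `a` and `g` in the free product, the reduced word of `a⁻¹ g` arises from those of `a` and `g`
by cancelling their longest common prefix and possibly merging one pair of syllables. Hence `a` is
a prefix of `g` times a remainder that can be read off from `a⁻¹ g` up to one syllable. If
`l(a) ≤ N`, there are at most `N + 1` such prefixes, and the merged syllable lies in a box of at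
most `(2N + 1) ^ m` elements, `m = f⁻¹(N)`. Two applications of the Cauchy-Schwarz inequality give
the decay function `(2N + 2) ^ ((m + 4) / 2)`, which is subexponential because `m log N = o(N)`.

On the other hand, applying the regular representation to indicator functions bounds the
multiplicative energy, whence `|B|² ≤ d(N)² |B B|` for every finite set `B` in the ball of radius
`N`. For a box of side proportional to `N` in `ℤⁿ` this forces a polynomial `d` to have degree at
least `n / 2`, and `G` contains `ℤⁿ` for every `n`.

The maps `v ↦ ∑ vᵢ Nⁱ` from `ℤⁿ` to `ℤ` show that `G` is residually free, because they do not
vanish on a given nonzero `v` once `N` is large. By Nielsen-Schreier the amenable subgroups of a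
free group are cyclic, so the amenable subgroups of `G` are commutative. A commutative subgroup of
a free product is cyclic or conjugate into a factor, hence finitely generated here.
-/

namespace GroupDecay

open Monoid

section ReducedLists

variable {ι : Type*} {G : ι → Type*} [∀ i, Group (G i)]

/-- A list of syllables is reduced if no syllable is trivial and adjacent syllables come from
different factors; these are the lists underlying `Monoid.CoprodI.Word`. -/
def IsReducedList (L : List (Σ i, G i)) : Prop :=
  (∀ l ∈ L, l.2 ≠ 1) ∧ L.IsChain fun l l' => l.1 ≠ l'.1

/-- The product in the free product of a list of syllables. -/
def listProd (L : List (Σ i, G i)) : CoprodI G :=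
  (L.map fun l => CoprodI.of l.2).prod

/-- The formal inverse of a list of syllables. -/
def invList (L : List (Σ i, G i)) : List (Σ i, G i) :=
  (L.map fun l => ⟨l.1, l.2⁻¹⟩).reverse

lemma listProd_nil : listProd ([] : List (Σ i, G i)) = 1 := rfl

lemma listProd_cons (a : Σ i, G i) (L : List (Σ i, G i)) :
    listProd (a :: L) = CoprodI.of a.2 * listProd L := by
  simp [listProd]

lemma listProd_append (L L' : List (Σ i, G i)) :
    listProd (L ++ L') = listProd L * listProd L' := by
  simp [listProd]

lemma invList_nil : invList ([] : List (Σ i, G i)) = [] := rfl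

lemma invList_cons (a : Σ i, G i) (L : List (Σ i, G i)) :
    invList (a :: L) = invList L ++ [⟨a.1, a.2⁻¹⟩] := by
  simp [invList]

lemma length_invList (L : List (Σ i, G i)) : (invList L).length = L.length := by
  simp [invList]

lemma listProd_invList (L : List (Σ i, G i)) : listProd (invList L) = (listProd L)⁻¹ := by
  induction L with
  | nil => simp [invList_nil, listProd_nil]
  | cons a L ih => simp [invList_cons, listProd_append, listProd_cons, ih, listProd_nil]

lemma isReducedList_nil : IsReducedList ([] : List (Σ i, G i)) := by
  simp [IsReducedList]

lemma isReducedList_singleton {a : Σ i, G i} (h : a.2 ≠ 1) : IsReducedList [a] := by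
  simp [IsReducedList, h]

lemma isReducedList_append {L L' : List (Σ i, G i)} :
    IsReducedList (L ++ L') ↔ IsReducedList L ∧ IsReducedList L' ∧
      ∀ a ∈ L.getLast?, ∀ b ∈ L'.head?, a.1 ≠ b.1 := by
  simp only [IsReducedList, List.mem_append, List.isChain_append]
  grind

lemma isReducedList_cons {a : Σ i, G i} {L : List (Σ i, G i)} :
    IsReducedList (a :: L) ↔ a.2 ≠ 1 ∧ IsReducedList L ∧ ∀ b ∈ L.head?, a.1 ≠ b.1 := by
  simp only [IsReducedList, List.mem_cons, List.isChain_cons]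
  grind

lemma IsReducedList.invList {L : List (Σ i, G i)} (h : IsReducedList L) :
    IsReducedList (invList L) := by
  refine ⟨?_, ?_⟩
  · simp only [GroupDecay.invList, List.mem_reverse, List.forall_mem_map, ne_eq, inv_eq_one]
    exact h.1
  · simpa [GroupDecay.invList, List.isChain_reverse, List.isChain_map, ne_comm] using h.2

lemma forall_getLast?_invList {L : List (Σ i, G i)} {p : ι → Prop} :
    (∀ a ∈ (invList L).getLast?, p a.1) ↔ ∀ a ∈ L.head?, p a.1 := by
  cases L <;> simp [invList]

lemma IsReducedList.invList_append {C D : List (Σ i, G i)} (hC : IsReducedList C)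
    (hD : IsReducedList D) (hne : ∀ a ∈ C.head?, ∀ b ∈ D.head?, a.1 ≠ b.1) :
    IsReducedList (GroupDecay.invList C ++ D) :=
  isReducedList_append.2 ⟨hC.invList, hD, forall_getLast?_invList
    (p := fun i => ∀ b ∈ D.head?, i ≠ b.1) |>.2 hne⟩

lemma IsReducedList.invList_append_merge {i : ι} {s t : G i} {C D : List (Σ i, G i)}
    (hC : IsReducedList (⟨i, s⟩ :: C)) (hD : IsReducedList (⟨i, t⟩ :: D)) (hst : s ≠ t) :
    IsReducedList (GroupDecay.invList C ++ ⟨i, s⁻¹ * t⟩ :: D) := by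
  obtain ⟨-, hC, hiC⟩ := isReducedList_cons.1 hC
  obtain ⟨-, hD, hiD⟩ := isReducedList_cons.1 hD
  refine hC.invList_append (isReducedList_cons.2 ⟨?_, hD, hiD⟩) ?_
  · simpa [inv_mul_eq_one] using hst
  · simpa [ne_comm] using hiC

lemma exists_common_prefix {α : Type*} (L L' : List α) :
    ∃ P C D, L = P ++ C ∧ L' = P ++ D ∧ ∀ c ∈ C.head?, ∀ d ∈ D.head?, c ≠ d := by
  induction L generalizing L' with
  | nil => exact ⟨[], [], L', rfl, rfl, by simp⟩
  | cons a L ih =>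
    cases L' with
    | nil => exact ⟨[], a :: L, [], rfl, rfl, by simp⟩
    | cons b L' =>
      by_cases hab : a = b
      · obtain ⟨P, C, D, h1, h2, h3⟩ := ih L'
        exact ⟨a :: P, C, D, by simp [h1], by simp [h2, hab], h3⟩
      · exact ⟨[], a :: L, b :: L', rfl, rfl, by simpa using hab⟩

end ReducedLists

section Syllables

variable {ι : Type*} {G : ι → Type*} [∀ i, Group (G i)] [DecidableEq ι] [∀ i, DecidableEq (G i)]

/-- The reduced list of syllables of an element of a free product. -/
def syllables (g : CoprodI G) : List (Σ i, G i) :=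
  (CoprodI.Word.equiv g).toList

lemma isReducedList_syllables (g : CoprodI G) : IsReducedList (syllables g) :=
  ⟨(CoprodI.Word.equiv g).ne_one, (CoprodI.Word.equiv g).chain_ne⟩

lemma listProd_syllables (g : CoprodI G) : listProd (syllables g) = g :=
  CoprodI.Word.equiv.symm_apply_apply g

lemma syllables_listProd {L : List (Σ i, G i)} (h : IsReducedList L) :
    syllables (listProd L) = L :=
  congrArg CoprodI.Word.toList
    (CoprodI.Word.equiv.apply_symm_apply (⟨L, h.1, h.2⟩ : CoprodI.Word G))

lemma syllables_eq {g : CoprodI G} {L : List (Σ i, G i)} (h : IsReducedList L)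
    (hg : listProd L = g) : syllables g = L := by
  rw [← hg, syllables_listProd h]

lemma syllables_injective : Function.Injective (syllables : CoprodI G → List (Σ i, G i)) :=
  Function.LeftInverse.injective listProd_syllables

lemma syllables_one : syllables (1 : CoprodI G) = [] :=
  syllables_eq isReducedList_nil listProd_nil

lemma syllables_eq_nil {g : CoprodI G} : syllables g = [] ↔ g = 1 := by
  rw [← syllables_one, syllables_injective.eq_iff]

lemma syllables_inv (g : CoprodI G) : syllables g⁻¹ = invList (syllables g) :=
  syllables_eq (isReducedList_syllables g).invList (by rw [listProd_invList, listProd_syllables])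

lemma syllables_of {i : ι} {m : G i} (h : m ≠ 1) :
    syllables (CoprodI.of m : CoprodI G) = [⟨i, m⟩] :=
  syllables_eq (isReducedList_singleton h) (by simp [listProd])

lemma isReducedList_of_syllables_eq_append {g : CoprodI G} {P C : List (Σ i, G i)}
    (h : syllables g = P ++ C) : IsReducedList C := by
  have hred := isReducedList_syllables g
  rw [h, isReducedList_append] at hred
  exact hred.2.1

lemma inv_mul_eq_of_syllables_eq_append {g h : CoprodI G} {P C D : List (Σ i, G i)}
    (hg : syllables g = P ++ C) (hh : syllables h = P ++ D) :
    g⁻¹ * h = listProd (invList C ++ D) := by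
  rw [← listProd_syllables g, ← listProd_syllables h, hg, hh, listProd_append, listProd_append,
    listProd_append, listProd_invList]
  group

lemma exists_syllables_inv_mul (g h : CoprodI G) :
    ∃ P C D, syllables g = P ++ C ∧ syllables h = P ++ D ∧
      (syllables (g⁻¹ * h) = invList C ++ D ∨
        ∃ (i : ι) (s t : G i) (C' D' : List (Σ i, G i)), C = ⟨i, s⟩ :: C' ∧ D = ⟨i, t⟩ :: D' ∧
          syllables (g⁻¹ * h) = invList C' ++ ⟨i, s⁻¹ * t⟩ :: D') := by
  obtain ⟨P, C, D, hg, hh, hne⟩ := exists_common_prefix (syllables g) (syllables h)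
  refine ⟨P, C, D, hg, hh, ?_⟩
  have hC := isReducedList_of_syllables_eq_append hg
  have hD := isReducedList_of_syllables_eq_append hh
  have hprod := inv_mul_eq_of_syllables_eq_append hg hh
  by_cases hidx : ∀ a ∈ C.head?, ∀ b ∈ D.head?, a.1 ≠ b.1
  · exact .inl (syllables_eq (hC.invList_append hD hidx) hprod.symm)
  · push Not at hidx
    obtain ⟨⟨i, s⟩, ha, ⟨j, t⟩, hb, rfl : i = j⟩ := hidx
    have hst : s ≠ t := fun h => hne _ ha _ hb (by rw [h])
    obtain ⟨C', rfl⟩ := List.head?_eq_some_iff.1 ha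
    obtain ⟨D', rfl⟩ := List.head?_eq_some_iff.1 hb
    refine .inr ⟨i, s, t, C', D', rfl, rfl, syllables_eq (hC.invList_append_merge hD hst) ?_⟩
    rw [hprod]
    simp [listProd_append, listProd_cons, invList_cons, mul_assoc]

lemma syllables_mul_eq_append_iff {g h : CoprodI G} :
    syllables (g * h) = syllables g ++ syllables h ↔
      ∀ a ∈ (syllables g).getLast?, ∀ b ∈ (syllables h).head?, a.1 ≠ b.1 := by
  refine ⟨fun H => ?_, fun H => syllables_eq (isReducedList_append.2
    ⟨isReducedList_syllables g, isReducedList_syllables h, H⟩) ?_⟩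
  · have hred := isReducedList_syllables (g * h)
    rw [H, isReducedList_append] at hred
    exact hred.2.2
  · rw [listProd_append, listProd_syllables, listProd_syllables]

end Syllables

section SyllableLength

variable {ι : Type*} {G : ι → Type*} [∀ i, Group (G i)] [DecidableEq ι] [∀ i, DecidableEq (G i)]

lemma length_syllables_inv (g : CoprodI G) : (syllables g⁻¹).length = (syllables g).length := by
  rw [syllables_inv, length_invList]

lemma length_syllables_mul_lt_or_eq_append (g h : CoprodI G) :
    (syllables (g * h)).length < (syllables g).length + (syllables h).length ∨
      syllables (g * h) = syllables g ++ syllables h := by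
  have hlen := length_syllables_inv g
  obtain ⟨P, C, D, hg, hh, hgh⟩ := exists_syllables_inv_mul g⁻¹ h
  rw [inv_inv] at hgh
  obtain hgh | ⟨i, s, t, C', D', rfl, rfl, hgh⟩ := hgh
  · cases P with
    | nil =>
      right
      rw [hgh, hh, List.nil_append, ← inv_inv g, syllables_inv g⁻¹, hg, List.nil_append]
    | cons p P =>
      left
      simp only [hg, hh, hgh, List.length_append, List.length_cons, length_invList] at hlen ⊢
      omega
  · left
    simp only [hg, hh, hgh, List.length_append, List.length_cons, length_invList] at hlen ⊢
    omega

lemma length_syllables_mul_eq_add_iff {g h : CoprodI G} :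
    (syllables (g * h)).length = (syllables g).length + (syllables h).length ↔
      syllables (g * h) = syllables g ++ syllables h :=
  ⟨(length_syllables_mul_lt_or_eq_append g h).resolve_left ∘ Eq.not_lt,
    fun H => by rw [H, List.length_append]⟩

lemma length_syllables_inv_mul_lt {x y : CoprodI G} (hx : x ≠ 1) (hxy : Commute x y)
    (happ : syllables (x * y) = syllables x ++ syllables y)
    (hle : (syllables x).length ≤ (syllables y).length) :
    (syllables (x⁻¹ * y)).length < (syllables y).length := by
  have happ' : syllables (y * x) = syllables y ++ syllables x := by
    rw [← length_syllables_mul_eq_add_iff, ← hxy.eq, happ, List.length_append, add_comm]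
  have hcomm : syllables x ++ syllables y = syllables y ++ syllables x := by
    rw [← happ, hxy.eq, happ']
  obtain ⟨E, hE⟩ : syllables x <+: syllables y :=
    List.prefix_of_prefix_length_le ⟨_, hcomm⟩ (List.prefix_append _ _) hle
  have hquot : syllables (x⁻¹ * y) = E :=
    syllables_eq (isReducedList_of_syllables_eq_append hE.symm)
      (inv_mul_eq_of_syllables_eq_append (List.append_nil _).symm hE.symm).symm
  have hpos : 0 < (syllables x).length := List.length_pos_iff.2 (mt syllables_eq_nil.1 hx)
  rw [hquot, ← hE, List.length_append]
  omega

/-- Since `x` starts and ends in different factors, `x` or `x⁻¹` can be placed in front of `y`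
without any cancellation. -/
lemma length_syllables_lt_of_commute {x y : CoprodI G} {a b : Σ i, G i}
    (ha : a ∈ (syllables x).head?) (hb : b ∈ (syllables x).getLast?) (hab : a.1 ≠ b.1)
    (hxy : Commute x y) (hle : (syllables x).length ≤ (syllables y).length) :
    (syllables (x⁻¹ * y)).length < (syllables y).length ∨
      (syllables (x * y)).length < (syllables y).length := by
  have hx : x ≠ 1 := by
    rintro rfl
    simp [syllables_one] at ha
  obtain ⟨c, L, hc⟩ : ∃ c L, syllables y = c :: L := by
    refine List.exists_cons_of_length_pos (lt_of_lt_of_le ?_ hle)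
    exact List.length_pos_iff.2 (mt syllables_eq_nil.1 hx)
  by_cases hbc : b.1 = c.1
  · right
    have happ : syllables (x⁻¹ * y) = syllables x⁻¹ ++ syllables y := by
      rw [syllables_mul_eq_append_iff, syllables_inv,
        forall_getLast?_invList (p := fun i => ∀ b ∈ (syllables y).head?, i ≠ b.1), hc,
        Option.mem_def.1 ha]
      simpa [← hbc] using hab
    simpa using length_syllables_inv_mul_lt (inv_ne_one.2 hx) hxy.inv_left happ
      (by rwa [length_syllables_inv])
  · left
    refine length_syllables_inv_mul_lt hx hxy (syllables_mul_eq_append_iff.2 ?_) hle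
    rw [hc, Option.mem_def.1 hb]
    simpa using hbc

lemma length_syllables_conj_lt {x : CoprodI G} {a b : Σ i, G i} {L : List (Σ i, G i)}
    (hx : syllables x = a :: L) (hb : b ∈ L.getLast?) (hab : a.1 = b.1) :
    (syllables ((CoprodI.of a.2)⁻¹ * x * CoprodI.of a.2)).length < (syllables x).length := by
  have hred := isReducedList_cons.1 (hx ▸ isReducedList_syllables x)
  have hL : syllables ((CoprodI.of a.2)⁻¹ * x) = L := by
    refine syllables_eq hred.2.1 ?_
    rw [← listProd_syllables x, hx, listProd_cons, inv_mul_cancel_left]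
  have ha := syllables_of hred.1
  rcases length_syllables_mul_lt_or_eq_append ((CoprodI.of a.2)⁻¹ * x) (CoprodI.of a.2) with h | h
  · simpa [hL, ha, hx] using h
  · rw [syllables_mul_eq_append_iff, hL, ha] at h
    exact absurd hab.symm (h b hb a rfl)

lemma exists_eq_of_mul (i : ι) (y : CoprodI G) :
    ∃ (t : G i) (z : CoprodI G), y = CoprodI.of t * z ∧ ∀ b ∈ (syllables z).head?, i ≠ b.1 := by
  by_cases hi : ∀ b ∈ (syllables y).head?, i ≠ b.1
  · exact ⟨1, y, by simp, hi⟩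
  · push Not at hi
    obtain ⟨⟨i, t⟩, hb, rfl⟩ := hi
    obtain ⟨L, hL⟩ := List.head?_eq_some_iff.1 hb
    have hred := isReducedList_cons.1 (hL ▸ isReducedList_syllables y)
    refine ⟨t, listProd L, ?_, ?_⟩
    · rw [← listProd_syllables y, hL, listProd_cons]
    · rw [syllables_listProd hred.2.1]
      exact hred.2.2

/-- If `z` starts outside the `i`-th factor, then `of u * z` is reduced as written, hence so is
`z * of s`, and the two words have different first letters. -/
lemma eq_one_of_of_mul_eq_mul_of {i : ι} {s u : G i} (hs : s ≠ 1) (hu : u ≠ 1) {z : CoprodI G}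
    (hz : ∀ b ∈ (syllables z).head?, i ≠ b.1)
    (h : CoprodI.of u * z = z * CoprodI.of s) : z = 1 := by
  have hleft : syllables (CoprodI.of u * z) = ⟨i, u⟩ :: syllables z := by
    rw [syllables_mul_eq_append_iff.2, syllables_of hu, List.singleton_append]
    simpa [syllables_of hu] using hz
  have hright : syllables (z * CoprodI.of s) = syllables z ++ [⟨i, s⟩] := by
    rw [← syllables_of hs, ← length_syllables_mul_eq_add_iff, ← h, hleft, syllables_of hs]
    simp
  rw [h, hright] at hleft
  cases hsyl : syllables z with
  | nil => exact syllables_eq_nil.1 hsyl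
  | cons c L =>
    rw [hsyl, List.cons_append, List.cons_eq_cons] at hleft
    exact absurd (congrArg Sigma.fst hleft.1).symm (hz c (by simp [hsyl]))

lemma le_zpowers_of_pairwise_commute {H : Subgroup (CoprodI G)}
    (hH : ∀ x ∈ H, ∀ y ∈ H, Commute x y) {x : CoprodI G} {a b : Σ i, G i} (hxH : x ∈ H)
    (ha : a ∈ (syllables x).head?) (hb : b ∈ (syllables x).getLast?) (hab : a.1 ≠ b.1)
    (hmin : ∀ y ∈ H, y ≠ 1 → (syllables x).length ≤ (syllables y).length) :
    H ≤ Subgroup.zpowers x := by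
  intro y hy
  induction hn : (syllables y).length using Nat.strong_induction_on generalizing y with
  | _ n ih =>
    subst hn
    rcases eq_or_ne y 1 with rfl | hy1
    · exact one_mem _
    rcases length_syllables_lt_of_commute ha hb hab (hH x hxH y hy) (hmin y hy hy1) with h | h
    · have hmem := ih _ h (mul_mem (inv_mem hxH) hy) rfl
      exact (Subgroup.mul_mem_cancel_left _ (inv_mem (Subgroup.mem_zpowers x))).1 hmem
    · have hmem := ih _ h (mul_mem hxH hy) rfl
      exact (Subgroup.mul_mem_cancel_left _ (Subgroup.mem_zpowers x)).1 hmem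

end SyllableLength

section AbelianSubgroups

variable {ι : Type*} {G : ι → Type*} [∀ i, Group (G i)]

lemma mem_range_of_commute {i : ι} {s : G i} (hs : s ≠ 1) {y : CoprodI G}
    (hy : Commute (CoprodI.of s) y) : y ∈ (CoprodI.of : G i →* CoprodI G).range := by
  classical
  obtain ⟨t, z, rfl, hz⟩ := exists_eq_of_mul i y
  have hconj : CoprodI.of (t⁻¹ * s * t) * z = z * CoprodI.of s := by
    have := hy.eq
    rw [map_mul, map_mul, map_inv, mul_assoc, mul_assoc, inv_mul_eq_iff_eq_mul, this, mul_assoc]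
  obtain rfl : z = 1 := by
    refine eq_one_of_of_mul_eq_mul_of hs (fun h => hs ?_) hz hconj
    rw [mul_assoc, inv_mul_eq_one] at h
    exact (mul_eq_right.1 h.symm)
  exact ⟨t, by simp⟩

lemma le_range_of_or_le_zpowers [DecidableEq ι] [∀ i, DecidableEq (G i)]
    {H : Subgroup (CoprodI G)} (hH : ∀ x ∈ H, ∀ y ∈ H, Commute x y) {x : CoprodI G}
    (hxH : x ∈ H) (hx : x ≠ 1)
    (hmin : ∀ g, ∀ y ∈ H, y ≠ 1 → (syllables x).length ≤ (syllables (g * y * g⁻¹)).length) :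
    (∃ i, H ≤ (CoprodI.of : G i →* CoprodI G).range) ∨ H ≤ Subgroup.zpowers x := by
  obtain ⟨⟨i, s⟩, L, hL⟩ := List.exists_cons_of_ne_nil (mt syllables_eq_nil.1 hx)
  have hred := isReducedList_cons.1 (hL ▸ isReducedList_syllables x)
  cases hlast : L.getLast? with
  | none =>
    left
    rw [List.getLast?_eq_none_iff] at hlast
    have hxs : x = CoprodI.of s := by
      rw [← listProd_syllables x, hL, hlast, listProd_cons, listProd_nil, mul_one]
    exact ⟨i, fun y hy => mem_range_of_commute hred.1 (hxs ▸ hH x hxH y hy)⟩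
  | some b =>
    right
    have hib : i ≠ b.1 := fun hib => by
      have hlt := length_syllables_conj_lt hL hlast hib
      have hle := hmin (CoprodI.of s)⁻¹ x hxH hx
      rw [inv_inv] at hle
      exact hlt.not_ge hle
    refine le_zpowers_of_pairwise_commute (a := ⟨i, s⟩) (b := b) hH hxH (by simp [hL]) ?_ hib
      fun y hy hy1 => by simpa using hmin 1 y hy hy1
    simp [hL, List.getLast?_cons, hlast]

lemma exists_map_conj_le_range_of_or_le_zpowers {H : Subgroup (CoprodI G)}
    (hH : ∀ x ∈ H, ∀ y ∈ H, Commute x y) :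
    ∃ g : CoprodI G,
      (∃ i, H.map (MulAut.conj g).toMonoidHom ≤ (CoprodI.of : G i →* CoprodI G).range) ∨
        ∃ x, H.map (MulAut.conj g).toMonoidHom ≤ Subgroup.zpowers x := by
  classical
  rcases H.bot_or_exists_ne_one with rfl | ⟨z, hzH, hz⟩
  · exact ⟨1, .inr ⟨1, by simp⟩⟩
  obtain ⟨⟨g, x⟩, ⟨hxH, hx⟩, hmin⟩ := exists_minimalFor_of_wellFoundedLT
    (fun p : CoprodI G × CoprodI G => p.2 ∈ H ∧ p.2 ≠ 1)
    (fun p => (syllables (p.1 * p.2 * p.1⁻¹)).length) ⟨(1, z), hzH, hz⟩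
  have hmin' : ∀ g' y, y ∈ H → y ≠ 1 →
      (syllables (g * x * g⁻¹)).length ≤ (syllables (g' * y * g'⁻¹)).length :=
    fun g' y hy hy1 => (le_total _ _).elim id (hmin (j := (g', y)) ⟨hy, hy1⟩)
  refine ⟨g, (le_range_of_or_le_zpowers (x := g * x * g⁻¹) ?_
    (Subgroup.mem_map_of_mem (MulAut.conj g).toMonoidHom hxH) (by simpa using hx) ?_).imp_right
      fun hle => ⟨_, hle⟩⟩
  · rintro _ ⟨u, hu, rfl⟩ _ ⟨v, hv, rfl⟩
    exact (hH u hu v hv).map _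
  · rintro g' _ ⟨u, hu, rfl⟩ hu1
    have := hmin' (g' * g) u hu (by rintro rfl; exact hu1 (map_one _))
    simpa [mul_assoc] using this

/-- The case of abelian subgroups of the Kurosh subgroup theorem. -/
theorem le_range_conj_of_or_le_zpowers {H : Subgroup (CoprodI G)}
    (hH : ∀ x ∈ H, ∀ y ∈ H, Commute x y) :
    (∃ g i, H ≤ ((MulAut.conj g).toMonoidHom.comp (CoprodI.of : G i →* CoprodI G)).range) ∨
      ∃ x, H ≤ Subgroup.zpowers x := by
  obtain ⟨g, ⟨i, hle⟩ | ⟨x, hle⟩⟩ := exists_map_conj_le_range_of_or_le_zpowers hH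
  · refine .inl ⟨g⁻¹, i, fun y hy => ?_⟩
    obtain ⟨s, hs⟩ := hle (Subgroup.mem_map_of_mem _ hy)
    exact ⟨s, by simp [hs, mul_assoc]⟩
  · refine .inr ⟨MulAut.conj g⁻¹ x, fun y hy => ?_⟩
    obtain ⟨k, hk : x ^ k = _⟩ := hle (Subgroup.mem_map_of_mem _ hy)
    refine ⟨k, ?_⟩
    change MulAut.conj g⁻¹ x ^ k = y
    rw [← map_zpow, hk]
    simp [mul_assoc]

lemma subgroup_fg_of_le_range {A B : Type*} [Group A] [Group B] (hA : ∀ K : Subgroup A, K.FG)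
    {φ : A →* B} {H : Subgroup B} (hle : H ≤ φ.range) : H.FG := by
  rw [← Subgroup.map_comap_eq_self hle, Subgroup.fg_iff_submonoid_fg]
  exact ((Subgroup.fg_iff_submonoid_fg _).1 (hA (H.comap φ))).map φ

lemma subgroup_multiplicative_fg {M : Type*} [AddCommGroup M] [IsNoetherian ℤ M]
    (K : Subgroup (Multiplicative M)) : K.FG := by
  have h : (AddSubgroup.toIntSubmodule (AddSubgroup.toSubgroup.symm K)).FG :=
    IsNoetherian.noetherian _
  rwa [Submodule.fg_iff_addSubgroup_fg, AddSubgroup.toIntSubmodule_toAddSubgroup,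
    AddSubgroup.fg_iff_mul_fg, OrderIso.apply_symm_apply] at h

theorem fg_of_pairwise_commute (hfg : ∀ i, ∀ K : Subgroup (G i), K.FG)
    {H : Subgroup (CoprodI G)} (hH : ∀ x ∈ H, ∀ y ∈ H, Commute x y) : H.FG := by
  rcases le_range_conj_of_or_le_zpowers hH with ⟨g, i, hle⟩ | ⟨x, hle⟩
  · exact subgroup_fg_of_le_range (hfg i) hle
  · refine subgroup_fg_of_le_range (φ := zpowersHom _ x) subgroup_multiplicative_fg
      (hle.trans fun y hy => ?_)
    obtain ⟨k, rfl⟩ := hy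
    exact ⟨Multiplicative.ofAdd k, by simp⟩

end AbelianSubgroups

section PolynomialGrowth

lemma prod_zpow_single_add {ι A : Type*} [Fintype ι] [DecidableEq ι] [CommGroup A] (v : ι → A)
    (t : ι) (k : ℤ) (e : ι → ℤ) :
    ∏ s, v s ^ (Pi.single t k + e : ι → ℤ) s = v t ^ k * ∏ s, v s ^ e s := by
  simp only [Pi.add_apply, zpow_add, Finset.prod_mul_distrib]
  rw [Fintype.prod_eq_single t fun s hs => by simp [hs], Pi.single_eq_same]

lemma exists_zpow_prod_eq {A : Type*} [CommGroup A] (S : Finset A) (w : List A)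
    (hw : ∀ s ∈ w, s ∈ S ∨ s⁻¹ ∈ S) :
    ∃ e : S → ℤ, (∀ s, |e s| ≤ w.length) ∧ ∏ s : S, (s : A) ^ e s = w.prod := by
  classical
  induction w with
  | nil => exact ⟨0, by simp, by simp⟩
  | cons a w ih =>
    obtain ⟨e, he, hprod⟩ := ih fun s hs => hw s (List.mem_cons_of_mem _ hs)
    obtain ⟨t, k, hk, hta⟩ : ∃ (t : S) (k : ℤ), |k| ≤ 1 ∧ (t : A) ^ k = a := by
      rcases hw a List.mem_cons_self with h | h
      · exact ⟨⟨a, h⟩, 1, by simp, by simp⟩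
      · exact ⟨⟨a⁻¹, h⟩, -1, by simp, by simp⟩
    refine ⟨Pi.single t k + e, fun s => ?_, ?_⟩
    · have hsingle : |(Pi.single t k : S → ℤ) s| ≤ 1 := by
        rcases eq_or_ne s t with rfl | hst
        · simpa using hk
        · simp [hst]
      refine (abs_add_le _ _).trans ?_
      rw [List.length_cons, Nat.cast_add_one]
      linarith [he s]
    · rw [prod_zpow_single_add (fun s : S => (s : A)), hta, hprod, List.prod_cons]

theorem hasPolynomialGrowth_of_commGroup {A : Type*} [CommGroup A] (hA : Group.FG A) :
    HasPolynomialGrowth A := by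
  classical
  refine ⟨hA, fun S hS _ => ?_⟩
  obtain ⟨S, rfl⟩ := hS.exists_finset_coe
  refine ⟨2 ^ S.card, S.card, fun n => ?_⟩
  let exponents : Finset (S → ℤ) := Fintype.piFinset fun _ => Finset.Icc (-(n : ℤ)) n
  let B : Finset A := exponents.image fun e => ∏ s : S, (s : A) ^ e s
  have hsub : wordBall (S : Set A) n ⊆ B := by
    rintro g ⟨w, hlen, hw, rfl⟩
    obtain ⟨e, he, hprod⟩ := exists_zpow_prod_eq S w (by simpa using hw)
    refine Finset.mem_coe.2 (Finset.mem_image.2 ⟨e, Fintype.mem_piFinset.2 fun s => ?_, hprod⟩)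
    rw [Finset.mem_Icc, ← abs_le]
    exact (he s).trans (by exact_mod_cast hlen)
  have hcard : exponents.card = (2 * n + 1) ^ S.card := by
    simp only [exponents, Fintype.card_piFinset, Int.card_Icc, Finset.prod_const,
      Finset.card_univ, Fintype.card_coe]
    congr 1
    omega
  calc (wordBall (S : Set A) n).ncard ≤ (B : Set A).ncard :=
        Set.ncard_le_ncard hsub (Finset.finite_toSet _)
    _ = B.card := Set.ncard_coe_finset B
    _ ≤ (2 * n + 1) ^ S.card := Finset.card_image_le.trans_eq hcard
    _ ≤ (2 * (n + 1)) ^ S.card := Nat.pow_le_pow_left (by omega) _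
    _ = 2 ^ S.card * (n + 1) ^ S.card := mul_pow _ _ _

end PolynomialGrowth

section FiberwiseCauchySchwarz

variable {α β γ π : Type*} [DecidableEq π]

lemma sq_sum_mul_le_card_image_mul_sum_fiber (S : Finset α) (k : α → π) (u y : α → ℝ) :
    (∑ a ∈ S, u a * y a) ^ 2 ≤ (S.image k).card *
      ∑ p ∈ S.image k, (∑ a ∈ S with k a = p, u a ^ 2) * ∑ a ∈ S with k a = p, y a ^ 2 := by
  rw [← Finset.sum_fiberwise_of_maps_to fun a ha => Finset.mem_image_of_mem k ha]
  refine sq_sum_le_card_mul_sum_sq.trans ?_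
  gcongr
  exact Finset.sum_mul_sq_le_sq_mul_sq _ _ _

lemma sum_comp_le_mul_sum_image [DecidableEq β] {T : Finset α} {b : α → β} {h : β → ℝ} {M : ℕ}
    (hh : ∀ x, 0 ≤ h x) (hM : ∀ x, (T.filter fun a => b a = x).card ≤ M) :
    ∑ a ∈ T, h (b a) ≤ M * ∑ x ∈ T.image b, h x := by
  rw [Finset.sum_comp, Finset.mul_sum]
  refine Finset.sum_le_sum fun x _ => ?_
  rw [nsmul_eq_mul]
  exact mul_le_mul_of_nonneg_right (mod_cast hM x) (hh x)

lemma sum_sum_filter_mem_le {S : Finset α} {T : α → Finset π} {c : α → ℝ} {K : ℕ}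
    (P : Finset π) (hc : ∀ a, 0 ≤ c a) (hK : ∀ a ∈ S, (T a).card ≤ K) :
    ∑ p ∈ P, ∑ a ∈ S with p ∈ T a, c a ≤ K * ∑ a ∈ S, c a := by
  simp only [Finset.sum_filter]
  rw [Finset.sum_comm, Finset.mul_sum]
  refine Finset.sum_le_sum fun a ha => ?_
  rw [← Finset.sum_filter, Finset.sum_const, nsmul_eq_mul]
  refine mul_le_mul_of_nonneg_right (mod_cast ?_) (hc a)
  exact (Finset.card_le_card fun p hp => (Finset.mem_filter.1 hp).2).trans (hK a ha)

variable {S : Finset α} {F : Finset γ} {κ : α → γ → π} {w : α → γ → β} {K M : ℕ}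

lemma sum_sum_fiber_sq_le [DecidableEq β] (p : π) {v : β → ℝ} {V : ℝ}
    (hM : ∀ b, ((S ×ˢ F).filter fun q => κ q.1 q.2 = p ∧ w q.1 q.2 = b).card ≤ M)
    (hV : ∀ T : Finset β, ∑ b ∈ T, v b ^ 2 ≤ V) :
    ∑ g ∈ F, ∑ a ∈ S with κ a g = p, v (w a g) ^ 2 ≤ M * V := by
  calc ∑ g ∈ F, ∑ a ∈ S with κ a g = p, v (w a g) ^ 2
      = ∑ q ∈ S ×ˢ F with κ q.1 q.2 = p, v (w q.1 q.2) ^ 2 := by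
        simp only [Finset.sum_filter]
        rw [Finset.sum_comm, Finset.sum_product]
    _ ≤ M * ∑ b ∈ {q ∈ S ×ˢ F | κ q.1 q.2 = p}.image fun q => w q.1 q.2, v b ^ 2 :=
        sum_comp_le_mul_sum_image (b := fun q : α × γ => w q.1 q.2) (h := fun b => v b ^ 2)
          (fun _ => sq_nonneg _) fun b => by simpa only [Finset.filter_filter] using hM b
    _ ≤ M * V := by gcongr; exact hV _

lemma sq_sum_mul_le_sum_mul_sum_fiber (u : α → ℝ) (y : α → ℝ) {g : γ} (hg : g ∈ F)
    (hK : (S.image fun a => κ a g).card ≤ K) :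
    (∑ a ∈ S, u a * y a) ^ 2 ≤ K * ∑ p ∈ (S ×ˢ F).image fun q => κ q.1 q.2,
      (∑ a ∈ S with p ∈ F.image (κ a), u a ^ 2) * ∑ a ∈ S with κ a g = p, y a ^ 2 := by
  have hX : ∀ p, 0 ≤ ∑ a ∈ S with p ∈ F.image (κ a), u a ^ 2 :=
    fun p => Finset.sum_nonneg fun _ _ => sq_nonneg _
  have hY : ∀ p, 0 ≤ ∑ a ∈ S with κ a g = p, y a ^ 2 :=
    fun p => Finset.sum_nonneg fun _ _ => sq_nonneg _
  refine (sq_sum_mul_le_card_image_mul_sum_fiber S (κ · g) u y).trans ?_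
  gcongr
  refine (Finset.sum_le_sum fun p _ => mul_le_mul_of_nonneg_right ?_ (hY p)).trans
    (Finset.sum_le_sum_of_subset_of_nonneg ?_ fun p _ _ => mul_nonneg (hX p) (hY p))
  · refine Finset.sum_le_sum_of_subset_of_nonneg (fun a ha => ?_) fun _ _ _ => sq_nonneg _
    obtain ⟨ha, hap⟩ := Finset.mem_filter.1 ha
    exact Finset.mem_filter.2 ⟨ha, Finset.mem_image.2 ⟨g, hg, hap⟩⟩
  · intro p hp
    obtain ⟨a, ha, rfl⟩ := Finset.mem_image.1 hp
    exact Finset.mem_image.2 ⟨(a, g), Finset.mk_mem_product ha hg, rfl⟩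

lemma sum_sq_sum_mul_le [DecidableEq β] (u : α → ℝ) {v : β → ℝ} {V : ℝ}
    (hK : ∀ a ∈ S, (F.image (κ a)).card ≤ K)
    (hK' : ∀ g ∈ F, (S.image fun a => κ a g).card ≤ K)
    (hM : ∀ p b, ((S ×ˢ F).filter fun q => κ q.1 q.2 = p ∧ w q.1 q.2 = b).card ≤ M)
    (hV : ∀ T : Finset β, ∑ b ∈ T, v b ^ 2 ≤ V) :
    ∑ g ∈ F, (∑ a ∈ S, u a * v (w a g)) ^ 2 ≤ K ^ 2 * M * (∑ a ∈ S, u a ^ 2) * V := by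
  have hV0 : 0 ≤ V := by simpa using hV ∅
  let P := (S ×ˢ F).image fun q => κ q.1 q.2
  let X : π → ℝ := fun p => ∑ a ∈ S with p ∈ F.image (κ a), u a ^ 2
  have (p : π) : 0 ≤ X p := Finset.sum_nonneg fun _ _ => sq_nonneg _
  calc ∑ g ∈ F, (∑ a ∈ S, u a * v (w a g)) ^ 2
      ≤ ∑ g ∈ F, K * ∑ p ∈ P, X p * ∑ a ∈ S with κ a g = p, v (w a g) ^ 2 :=
        Finset.sum_le_sum fun g hg =>
          sq_sum_mul_le_sum_mul_sum_fiber u (fun a => v (w a g)) hg (hK' g hg)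
    _ = K * ∑ p ∈ P, X p * ∑ g ∈ F, ∑ a ∈ S with κ a g = p, v (w a g) ^ 2 := by
        rw [← Finset.mul_sum, Finset.sum_comm]
        simp only [Finset.mul_sum]
    _ ≤ K * ∑ p ∈ P, X p * (M * V) := by
        gcongr with p _
        exact sum_sum_fiber_sq_le p (hM p) hV
    _ = K * ((∑ p ∈ P, X p) * (M * V)) := by rw [Finset.sum_mul]
    _ ≤ K * ((K * ∑ a ∈ S, u a ^ 2) * (M * V)) := by
        gcongr
        exact sum_sum_filter_mem_le P (fun _ => sq_nonneg _) hK
    _ = K ^ 2 * M * (∑ a ∈ S, u a ^ 2) * V := by ring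

end FiberwiseCauchySchwarz

section RegularNorm

variable {G : Type*} [Group G]

lemma lift_leftRegular_apply (x : MonoidAlgebra ℂ G) (ξ : EllTwo G) (g : G) :
    (MonoidAlgebra.lift ℂ (EllTwo G →L[ℂ] EllTwo G) G (leftRegular G) x ξ : EllTwo G) g =
      ∑ a ∈ x.coeff.support, x.coeff a * ξ (a⁻¹ * g) := by
  rw [MonoidAlgebra.lift_apply, Finsupp.sum, sum_apply, lp.coeFn_sum, Finset.sum_apply]
  rfl

lemma sum_norm_sq_le_norm_sq {α : Type*} (ξ : EllTwo α) (F : Finset α) :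
    ∑ g ∈ F, ‖ξ g‖ ^ 2 ≤ ‖ξ‖ ^ 2 := by
  simpa using lp.sum_rpow_le_norm_rpow (p := 2) (by norm_num) ξ F

lemma norm_le_of_sum_norm_sq_le {α : Type*} {ξ : EllTwo α} {C : ℝ} (hC : 0 ≤ C)
    (h : ∀ F : Finset α, ∑ g ∈ F, ‖ξ g‖ ^ 2 ≤ C ^ 2) : ‖ξ‖ ≤ C :=
  lp.norm_le_of_forall_sum_le (p := 2) (by norm_num) hC (by simpa using h)

lemma twoNorm_nonneg (x : MonoidAlgebra ℂ G) : 0 ≤ twoNorm x := Real.sqrt_nonneg _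

lemma twoNorm_sq (x : MonoidAlgebra ℂ G) :
    twoNorm x ^ 2 = ∑ a ∈ x.coeff.support, ‖x.coeff a‖ ^ 2 :=
  Real.sq_sqrt (Finset.sum_nonneg fun _ _ => sq_nonneg _)

lemma card_filter_factorization_le [DecidableEq G] {S F : Finset G} {κ : G → G → G}
    {C : G → Finset G} (hκ : ∀ a ∈ S, ∀ g, (κ a g)⁻¹ * a ∈ C (a⁻¹ * g)) (p b : G) :
    ((S ×ˢ F).filter fun q => κ q.1 q.2 = p ∧ q.1⁻¹ * q.2 = b).card ≤ (C b).card := by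
  refine Finset.card_le_card_of_injOn (fun q => p⁻¹ * q.1) ?_ ?_
  · rintro ⟨a, g⟩ hq
    obtain ⟨hag, rfl, rfl⟩ := Finset.mem_filter.1 hq
    have ha : a ∈ S := (Finset.mem_product.1 hag).1
    exact hκ a ha g
  · rintro ⟨a, g⟩ hq ⟨a', g'⟩ hq' h
    obtain rfl : a = a' := mul_left_cancel h
    have hb := (Finset.mem_filter.1 hq).2.2.trans (Finset.mem_filter.1 hq').2.2.symm
    exact Prod.ext rfl (mul_left_cancel hb)

/-- Each support element `a` is split, relative to `g`, as `κ a g * c`. The hypotheses bound the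
number of left factors `κ a g` for fixed `a` and for fixed `g`, and the number of right factors `c`
for a fixed value of `a⁻¹ * g`. -/
theorem regularNorm_le_of_factorization [DecidableEq G] (x : MonoidAlgebra ℂ G) {κ : G → G → G}
    {K M : ℕ} {C : G → Finset G}
    (hK : ∀ a ∈ x.coeff.support, ∀ F : Finset G, (F.image (κ a)).card ≤ K)
    (hK' : ∀ g, (x.coeff.support.image fun a => κ a g).card ≤ K)
    (hC : ∀ b, (C b).card ≤ M)
    (hκ : ∀ a ∈ x.coeff.support, ∀ g, (κ a g)⁻¹ * a ∈ C (a⁻¹ * g)) :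
    regularNorm x ≤ K * √M * twoNorm x := by
  have hbound : 0 ≤ K * √M * twoNorm x :=
    mul_nonneg (by positivity) (twoNorm_nonneg x)
  refine ContinuousLinearMap.opNorm_le_bound _ hbound fun ξ => ?_
  refine norm_le_of_sum_norm_sq_le (mul_nonneg hbound (norm_nonneg _)) fun F => ?_
  calc _ ≤ ∑ g ∈ F, (∑ a ∈ x.coeff.support, ‖x.coeff a‖ * ‖ξ (a⁻¹ * g)‖) ^ 2 := by
        gcongr with g _
        rw [lift_leftRegular_apply]
        exact (norm_sum_le _ _).trans_eq (by simp only [norm_mul])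
    _ ≤ K ^ 2 * M * (∑ a ∈ x.coeff.support, ‖x.coeff a‖ ^ 2) * ‖ξ‖ ^ 2 :=
        sum_sq_sum_mul_le (w := fun a g => a⁻¹ * g) (v := fun b => ‖ξ b‖) (fun a => ‖x.coeff a‖)
          (fun a ha => hK a ha F) (fun g _ => hK' g)
          (fun p b => (card_filter_factorization_le hκ p b).trans (hC b))
          (sum_norm_sq_le_norm_sq ξ)
    _ = (K * √M * twoNorm x * ‖ξ‖) ^ 2 := by
        rw [mul_pow, mul_pow, mul_pow, Real.sq_sqrt (Nat.cast_nonneg _), twoNorm_sq]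

end RegularNorm

section FreeProduct

variable {ι : Type*} {G : ι → Type*} [∀ i, Group (G i)] [DecidableEq ι] [∀ i, DecidableEq (G i)]

/-- The elements `c` with at most `N` syllables, all taken from the sets `E i`, that can cancel
completely in a product `b = c⁻¹ * d`: for some `r ≤ N`, either `c⁻¹` is the product of the first
`r` syllables of `b`, or the first syllable of `c` has been merged into the syllable of `b` that
follows them. -/
def cancellingFactors (E : ∀ i, Finset (G i)) (N : ℕ) (b : CoprodI G) : Finset (CoprodI G) :=
  (Finset.range (N + 1)).biUnion fun r =>
    insert (listProd ((syllables b).take r))⁻¹ <|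
      match (syllables b)[r]? with
      | none => ∅
      | some l => (E l.1).image fun s => CoprodI.of s * (listProd ((syllables b).take r))⁻¹

lemma card_cancellingFactors_le {E : ∀ i, Finset (G i)} {N B : ℕ} (hE : ∀ i, (E i).card ≤ B)
    (b : CoprodI G) : (cancellingFactors E N b).card ≤ (N + 1) * (B + 1) := by
  refine (Finset.card_biUnion_le_card_mul _ _ (B + 1) fun r _ => ?_).trans_eq (by simp)
  refine (Finset.card_insert_le _ _).trans (Nat.succ_le_succ ?_)
  cases (syllables b)[r]? with
  | none => simp
  | some l => exact Finset.card_image_le.trans (hE _)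

lemma listProd_mem_cancellingFactors {E : ∀ i, Finset (G i)} {N : ℕ} {b : CoprodI G}
    {C D : List (Σ i, G i)} (hN : C.length ≤ N) (hb : syllables b = invList C ++ D) :
    listProd C ∈ cancellingFactors E N b := by
  refine Finset.mem_biUnion.2 ⟨C.length, Finset.mem_range.2 (by omega), ?_⟩
  rw [hb, List.take_left' (length_invList C), listProd_invList, inv_inv]
  exact Finset.mem_insert_self _ _

lemma listProd_cons_mem_cancellingFactors {E : ∀ i, Finset (G i)} {N : ℕ} {b : CoprodI G} {i : ι}
    {s t : G i} {C D : List (Σ i, G i)} (hN : C.length ≤ N) (hs : s ∈ E i)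
    (hb : syllables b = invList C ++ ⟨i, t⟩ :: D) :
    listProd (⟨i, s⟩ :: C) ∈ cancellingFactors E N b := by
  refine Finset.mem_biUnion.2 ⟨C.length, Finset.mem_range.2 (by omega), ?_⟩
  have hget : (syllables b)[C.length]? = some ⟨i, t⟩ := by simp [hb, length_invList]
  rw [hget, hb, List.take_left' (length_invList C), listProd_invList, inv_inv, listProd_cons]
  exact Finset.mem_insert_of_mem (Finset.mem_image_of_mem _ hs)

lemma exists_common_prefix_mem_cancellingFactors (E : ∀ i, Finset (G i)) (N : ℕ)
    (a g : CoprodI G) :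
    ∃ P, P <+: syllables a ∧ P <+: syllables g ∧
      ((syllables a).length ≤ N → (∀ l ∈ syllables a, l.2 ∈ E l.1) →
        (listProd P)⁻¹ * a ∈ cancellingFactors E N (a⁻¹ * g)) := by
  obtain ⟨P, C, D, ha, hg, h⟩ := exists_syllables_inv_mul a g
  refine ⟨P, ⟨C, ha.symm⟩, ⟨D, hg.symm⟩, fun hN hE => ?_⟩
  have hrest : (listProd P)⁻¹ * a = listProd C := by
    rw [inv_mul_eq_iff_eq_mul, ← listProd_append, ← ha, listProd_syllables]
  rw [ha, List.length_append] at hN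
  rw [hrest]
  rcases h with h | ⟨i, s, t, C', D', rfl, rfl, h⟩
  · exact listProd_mem_cancellingFactors (by omega) h
  · rw [List.length_cons] at hN
    exact listProd_cons_mem_cancellingFactors (by omega) (hE ⟨i, s⟩ (by simp [ha])) h

lemma card_image_listProd_prefix_le {α : Type*} {A : Finset α} {P : α → List (Σ i, G i)}
    {L : List (Σ i, G i)} {N : ℕ} (hP : ∀ a ∈ A, P a <+: L)
    (hN : ∀ a ∈ A, (P a).length ≤ N) : (A.image fun a => listProd (P a)).card ≤ N + 1 := by
  have hsub : (A.image fun a => listProd (P a)) ⊆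
      (Finset.range (N + 1)).image fun r => listProd (L.take r) := by
    refine Finset.image_subset_iff.2 fun a ha => Finset.mem_image.2 ⟨(P a).length, ?_, ?_⟩
    · exact Finset.mem_range.2 (Nat.lt_succ_of_le (hN a ha))
    · rw [← List.prefix_iff_eq_take.1 (hP a ha)]
  exact (Finset.card_le_card hsub).trans (Finset.card_image_le.trans_eq (Finset.card_range _))

/-- A Haagerup-type inequality for free products. -/
theorem regularNorm_le_of_syllables {E : ∀ i, Finset (G i)} {N B : ℕ}
    (hE : ∀ i, (E i).card ≤ B) {x : MonoidAlgebra ℂ (CoprodI G)}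
    (hN : ∀ a ∈ x.coeff.support, (syllables a).length ≤ N)
    (hx : ∀ a ∈ x.coeff.support, ∀ l ∈ syllables a, l.2 ∈ E l.1) :
    regularNorm x ≤ (N + 1 : ℕ) * √((N + 1) * (B + 1) : ℕ) * twoNorm x := by
  choose P hPa hPg hP using exists_common_prefix_mem_cancellingFactors (G := G) E N
  have hlen : ∀ a ∈ x.coeff.support, ∀ g, (P a g).length ≤ N :=
    fun a ha g => (hPa a g).length_le.trans (hN a ha)
  exact regularNorm_le_of_factorization x (κ := fun a g => listProd (P a g))
    (fun a ha F => card_image_listProd_prefix_le (fun g _ => hPa a g) fun g _ => hlen a ha g)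
    (fun g => card_image_listProd_prefix_le (fun a _ => hPg a g) fun a ha => hlen a ha g)
    (card_cancellingFactors_le hE) fun a ha g => hP a g (hN a ha) (hx a ha)

end FreeProduct

section Length

variable {f : ℕ → ℕ} {N : ℕ} {n : ℕ+} {g : FreeProdZ}

lemma freeProdLength_eq (f : ℕ → ℕ) (g : FreeProdZ) :
    freeProdLength f g = (((syllables g).map (syllableLength f)).sum : ℕ) := rfl

lemma freeProdLength_le_natCast :
    freeProdLength f g ≤ N ↔ ((syllables g).map (syllableLength f)).sum ≤ N :=
  Nat.cast_le

lemma syllableLength_inv (f : ℕ → ℕ) (s : ZPow n) :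
    syllableLength f ⟨n, s⁻¹⟩ = syllableLength f ⟨n, s⟩ := by
  simp [syllableLength]

lemma syllableLength_mul_le (f : ℕ → ℕ) (s t : ZPow n) :
    syllableLength f ⟨n, s * t⟩ ≤ syllableLength f ⟨n, s⟩ + syllableLength f ⟨n, t⟩ := by
  simp only [syllableLength, ← mul_add, ← Finset.sum_add_distrib]
  gcongr with i _
  exact Int.natAbs_add_le _ _

lemma sum_syllableLength_invList (f : ℕ → ℕ) (L : List (Σ n : ℕ+, ZPow n)) :
    ((invList L).map (syllableLength f)).sum = (L.map (syllableLength f)).sum := by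
  induction L with
  | nil => rfl
  | cons a L ih => simp [invList_cons, ih, syllableLength_inv, add_comm]

lemma freeProdLength_inv (f : ℕ → ℕ) (g : FreeProdZ) :
    freeProdLength f g⁻¹ = freeProdLength f g := by
  rw [freeProdLength_eq, freeProdLength_eq, syllables_inv, sum_syllableLength_invList]

lemma freeProdLength_inv_mul_le (f : ℕ → ℕ) (g h : FreeProdZ) :
    freeProdLength f (g⁻¹ * h) ≤ freeProdLength f g + freeProdLength f h := by
  simp only [freeProdLength_eq]
  norm_cast
  obtain ⟨P, C, D, hg, hh, hgh | ⟨i, s, t, C', D', rfl, rfl, hgh⟩⟩ := exists_syllables_inv_mul g h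
  · simp only [hg, hh, hgh, List.map_append, List.sum_append, sum_syllableLength_invList]
    omega
  · have hst := syllableLength_mul_le f s⁻¹ t
    rw [syllableLength_inv] at hst
    simp only [hg, hh, hgh, List.map_append, List.sum_append, sum_syllableLength_invList,
      List.map_cons, List.sum_cons]
    omega

theorem isLengthFunction_freeProdLength (f : ℕ → ℕ) : IsLengthFunction (freeProdLength f) where
  nonneg _ := Nat.cast_nonneg _
  map_one := by simp [freeProdLength_eq, syllables_one]
  map_inv := freeProdLength_inv f
  map_mul_le g h := by simpa [freeProdLength_inv] using freeProdLength_inv_mul_le f g⁻¹ h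

lemma natAbs_le_sum (s : ZPow n) (i : Fin n) :
    (s.toAdd i).natAbs ≤ ∑ j, (s.toAdd j).natAbs :=
  Finset.single_le_sum (f := fun j => (s.toAdd j).natAbs) (fun _ _ => Nat.zero_le _)
    (Finset.mem_univ i)

lemma le_syllableLength {s : ZPow n} (hs : s ≠ 1) : f n ≤ syllableLength f ⟨n, s⟩ := by
  obtain ⟨i, hi⟩ := Function.ne_iff.1 (toAdd_eq_zero.not.2 hs)
  exact Nat.le_mul_of_pos_right _ ((Int.natAbs_pos.2 hi).trans_le (natAbs_le_sum s i))

lemma syllableLength_le (hg : freeProdLength f g ≤ N) {l : Σ n : ℕ+, ZPow n}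
    (hl : l ∈ syllables g) : syllableLength f l ≤ N :=
  (List.single_le_sum (by simp) _ (List.mem_map_of_mem hl)).trans (freeProdLength_le_natCast.1 hg)

lemma length_syllables_le (hpos : ∀ n : ℕ+, 1 ≤ f n) (hg : freeProdLength f g ≤ N) :
    (syllables g).length ≤ N := by
  have hsyll : ∀ k ∈ (syllables g).map (syllableLength f), 1 ≤ k := by
    intro k hk
    obtain ⟨⟨n, s⟩, hl, rfl⟩ := List.mem_map.1 hk
    exact (hpos n).trans (le_syllableLength ((isReducedList_syllables g).1 _ hl))
  have hlen := List.length_le_sum_of_one_le _ hsyll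
  rw [List.length_map] at hlen
  exact hlen.trans (freeProdLength_le_natCast.1 hg)

/-- The box of elements of `ℤⁿ` with coordinates of absolute value at most `k`. -/
noncomputable def intBox (n : ℕ+) (k : ℕ) : Finset (ZPow n) :=
  (Fintype.piFinset fun _ : Fin n => Finset.Icc (-(k : ℤ)) k).map Multiplicative.ofAdd.toEmbedding

lemma mem_intBox {k : ℕ} {v : ZPow n} : v ∈ intBox n k ↔ ∀ i, (v.toAdd i).natAbs ≤ k := by
  simp only [intBox, Finset.mem_map_equiv, Fintype.mem_piFinset, Finset.mem_Icc]
  exact forall_congr' fun i => by change _ ≤ v.toAdd i ∧ v.toAdd i ≤ _ ↔ _; omega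

lemma card_intBox (n : ℕ+) (k : ℕ) : (intBox n k).card = (2 * k + 1) ^ (n : ℕ) := by
  rw [intBox, Finset.card_map, Fintype.card_piFinset_const, Int.card_Icc,
    show ((k : ℤ) + 1 - -k).toNat = 2 * k + 1 by omega]

/-- The box of `ℤⁿ` of size `N`, or the empty set if the generators of `ℤⁿ` have length greater
than `N`. It contains every nontrivial element of `ℤⁿ` of length at most `N`. -/
noncomputable def syllableBox (f : ℕ → ℕ) (N : ℕ) (n : ℕ+) : Finset (ZPow n) :=
  if f n ≤ N then intBox n N else ∅

lemma mem_syllableBox (hpos : 1 ≤ f n) {s : ZPow n} (hs : s ≠ 1)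
    (h : syllableLength f ⟨n, s⟩ ≤ N) : s ∈ syllableBox f N n := by
  rw [syllableBox, if_pos ((le_syllableLength hs).trans h), mem_intBox]
  exact fun i => (natAbs_le_sum s i).trans ((Nat.le_mul_of_pos_left _ hpos).trans h)

lemma le_floorInverse (hlim : Tendsto f atTop atTop) {n : ℕ} (hn : 1 ≤ n) (h : f n ≤ N) :
    n ≤ floorInverse f N := by
  obtain ⟨M, hM⟩ := eventually_atTop.1 (hlim.eventually_gt_atTop N)
  refine le_csSup ⟨M, fun k hk => ?_⟩ ⟨hn, h⟩
  by_contra! hMk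
  exact (hM k hMk.le).not_ge hk.2

lemma card_syllableBox_le (hlim : Tendsto f atTop atTop) (N : ℕ) (n : ℕ+) :
    (syllableBox f N n).card ≤ (2 * N + 1) ^ floorInverse f N := by
  rw [syllableBox]
  split_ifs with h
  · rw [card_intBox]
    exact Nat.pow_le_pow_right (by omega) (le_floorInverse hlim n.2 h)
  · exact Nat.zero_le _

end Length

section SubexponentialDecay

variable {f : ℕ → ℕ}

lemma isSubexponential_of_isLittleO_log {d : ℕ → ℝ} (hd : ∀ n, 0 < d n)
    (hlog : (fun n => Real.log (d n)) =o[atTop] fun n => (n : ℝ)) : IsSubexponential d := by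
  refine ⟨fun n => (hd n).le, ?_⟩
  have h := (Real.continuous_exp.tendsto 0).comp hlog.tendsto_div_nhds_zero
  rw [Real.exp_zero] at h
  refine h.congr fun n => ?_
  rw [Function.comp_apply, Real.rpow_def_of_pos (hd n), mul_one_div]

lemma isBigO_log_two_mul_add_two :
    (fun N : ℕ => Real.log (2 * N + 2)) =O[atTop] fun N : ℕ => Real.log N := by
  refine IsBigO.of_bound 2 ?_
  filter_upwards [eventually_ge_atTop 3] with N hN
  have hN' : (3 : ℝ) ≤ N := mod_cast hN
  rw [Real.norm_of_nonneg (Real.log_nonneg (by linarith)),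
    Real.norm_of_nonneg (Real.log_nonneg (by linarith)), ← Nat.cast_ofNat (R := ℝ), ← Real.log_pow]
  refine Real.log_le_log (by positivity) ?_
  norm_num
  nlinarith

lemma isLittleO_log_natCast : (fun N : ℕ => Real.log N) =o[atTop] fun N : ℕ => (N : ℝ) :=
  Real.isLittleO_log_id_atTop.comp_tendsto tendsto_natCast_atTop_atTop

lemma isSubexponential_sqrt_pow {m : ℕ → ℕ} (k : ℕ)
    (hm : (fun N : ℕ => (m N : ℝ)) =o[atTop] fun N : ℕ => (N : ℝ) / Real.log N) :
    IsSubexponential fun N => √((2 * N + 2 : ℝ) ^ (m N + k)) := by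
  refine isSubexponential_of_isLittleO_log (fun N => by positivity) ?_
  have hmlog : (fun N : ℕ => m N * Real.log (2 * N + 2)) =o[atTop] fun N : ℕ => (N : ℝ) := by
    refine (hm.mul_isBigO isBigO_log_two_mul_add_two).congr' EventuallyEq.rfl ?_
    filter_upwards [eventually_ge_atTop 2] with N hN
    exact div_mul_cancel₀ _ (Real.log_pos (mod_cast hN)).ne'
  have hklog : (fun N : ℕ => k * Real.log (2 * N + 2)) =o[atTop] fun N : ℕ => (N : ℝ) :=
    (isBigO_log_two_mul_add_two.trans_isLittleO isLittleO_log_natCast).const_mul_left _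
  refine ((hmlog.add hklog).const_mul_left (1 / 2)).congr_left fun N => ?_
  rw [Real.log_sqrt (by positivity), Real.log_pow]
  push_cast
  ring

lemma mul_sqrt_le_sqrt_pow (N m : ℕ) :
    (N + 1 : ℕ) * √((N + 1) * ((2 * N + 1) ^ m + 1) : ℕ) ≤ √((2 * N + 2 : ℝ) ^ (m + 4)) := by
  refine Real.le_sqrt_of_sq_le ?_
  rw [mul_pow, Real.sq_sqrt (Nat.cast_nonneg _)]
  norm_cast
  calc (N + 1) ^ 2 * ((N + 1) * ((2 * N + 1) ^ m + 1))
      = (N + 1) ^ 3 * ((2 * N + 1) ^ m + 1) := by ring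
    _ ≤ (2 * N + 2) ^ 3 * ((2 * N + 2) ^ m + (2 * N + 2) ^ m) := by
        gcongr <;> first | omega | exact Nat.one_le_pow _ _ (by omega)
    _ = (2 * N + 2) ^ (m + 3) * 2 := by ring
    _ ≤ (2 * N + 2) ^ (m + 3) * (2 * N + 2) := by gcongr; omega
    _ = (2 * N + 2) ^ (m + 4) := (pow_succ _ _).symm

lemma isDecayFunction_freeProdLength (hpos : ∀ n : ℕ+, 1 ≤ f n) (hlim : Tendsto f atTop atTop) :
    IsDecayFunction (freeProdLength f) fun N => √((2 * N + 2 : ℝ) ^ (floorInverse f N + 4)) := by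
  intro N x hx
  refine (regularNorm_le_of_syllables (card_syllableBox_le hlim N)
    (fun a ha => length_syllables_le hpos (hx a ha)) fun a ha l hl => ?_).trans
    (mul_le_mul_of_nonneg_right (mul_sqrt_le_sqrt_pow N _) (twoNorm_nonneg x))
  exact mem_syllableBox (hpos l.1) ((isReducedList_syllables a).1 l hl)
    (syllableLength_le (hx a ha) hl)

theorem hasSDWithRespectTo_freeProdLength (hpos : ∀ n : ℕ+, 1 ≤ f n)
    (hlim : Tendsto f atTop atTop)
    (hinv : (fun N : ℕ => (floorInverse f N : ℝ)) =o[atTop] fun N : ℕ => (N : ℝ) / Real.log N) :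
    HasSDWithRespectTo (freeProdLength f) :=
  ⟨isLengthFunction_freeProdLength f, _, isSubexponential_sqrt_pow 4 hinv,
    isDecayFunction_freeProdLength hpos hlim⟩

end SubexponentialDecay

section Energy

open scoped Combinatorics.Additive Pointwise

/-- The indicator function of a finite subset, as an element of the group algebra. -/
noncomputable def indicatorAlgebra {G : Type*} (s : Finset G) : MonoidAlgebra ℂ G :=
  ∑ a ∈ s, MonoidAlgebra.single a 1

variable {G : Type*}

lemma coeff_indicatorAlgebra [DecidableEq G] (s : Finset G) (g : G) :
    (indicatorAlgebra s).coeff g = if g ∈ s then 1 else 0 := by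
  simp [indicatorAlgebra, Finsupp.single_apply]

lemma support_indicatorAlgebra (s : Finset G) : (indicatorAlgebra s).coeff.support = s := by
  classical
  ext g
  simp [coeff_indicatorAlgebra]

/-- The indicator function of a finite subset, as an element of `ℓ²`. -/
noncomputable def indicatorEllTwo [DecidableEq G] (s : Finset G) : EllTwo G :=
  ∑ a ∈ s, lp.single 2 a 1

lemma norm_indicatorEllTwo_sq [DecidableEq G] (s : Finset G) :
    ‖indicatorEllTwo s‖ ^ 2 = s.card := by
  simpa [indicatorEllTwo] using lp.norm_sum_single (p := 2) (by norm_num) (fun _ : G => (1 : ℂ)) s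

variable [Group G]

lemma twoNorm_indicatorAlgebra_sq (s : Finset G) : twoNorm (indicatorAlgebra s) ^ 2 = s.card := by
  classical
  rw [twoNorm_sq, support_indicatorAlgebra,
    Finset.sum_congr rfl (g := fun _ => 1) fun a ha => by simp [coeff_indicatorAlgebra, ha]]
  simp

variable [DecidableEq G]

lemma lift_leftRegular_indicatorAlgebra (s t : Finset G) (g : G) :
    (MonoidAlgebra.lift ℂ (EllTwo G →L[ℂ] EllTwo G) G (leftRegular G) (indicatorAlgebra s)
      (indicatorEllTwo t) : EllTwo G) g = ((s ×ˢ t).filter fun q => q.1 * q.2 = g).card := by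
  have hsingle : ∀ a b, leftTranslate a (lp.single 2 b 1 : EllTwo G) g =
      if a * b = g then 1 else 0 := fun a b => by
    simp [leftTranslate_apply, Pi.single_apply, inv_mul_eq_iff_eq_mul, eq_comm (a := g)]
  rw [Finset.card_filter, Finset.sum_product_right]
  push_cast
  simp only [← hsingle]
  simp only [indicatorAlgebra, indicatorEllTwo, map_sum, MonoidAlgebra.lift_single, one_smul,
    sum_apply, lp.coeFn_sum]
  refine (Finset.sum_apply _ _ _).trans (Finset.sum_congr rfl fun b _ => ?_)
  exact Finset.sum_apply _ _ _

lemma mulEnergy_le_regularNorm_sq_mul_card (s t : Finset G) :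
    Eₘ[s, t] ≤ regularNorm (indicatorAlgebra s) ^ 2 * t.card := by
  set T := MonoidAlgebra.lift ℂ (EllTwo G →L[ℂ] EllTwo G) G (leftRegular G) (indicatorAlgebra s)
    with hT
  have hnorm : ‖T (indicatorEllTwo t)‖ ≤ ‖T‖ * ‖indicatorEllTwo t‖ := T.le_opNorm _
  calc (Eₘ[s, t] : ℝ) = ∑ g ∈ s * t, ‖(T (indicatorEllTwo t) : EllTwo G) g‖ ^ 2 := by
        simp [Finset.mulEnergy_eq_sum_sq', hT, lift_leftRegular_indicatorAlgebra]
    _ ≤ ‖T (indicatorEllTwo t)‖ ^ 2 := sum_norm_sq_le_norm_sq _ _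
    _ ≤ (‖T‖ * ‖indicatorEllTwo t‖) ^ 2 := by gcongr
    _ = regularNorm (indicatorAlgebra s) ^ 2 * t.card := by
        rw [mul_pow, norm_indicatorEllTwo_sq, regularNorm]

lemma IsDecayFunction.card_mul_card_le {l : G → ℝ} {d : ℕ → ℝ} (hd : IsDecayFunction l d) {N : ℕ}
    {s t : Finset G} (hs : ∀ a ∈ s, l a ≤ N) :
    (s.card * t.card : ℝ) ≤ d N ^ 2 * (s * t).card := by
  rcases s.eq_empty_or_nonempty with rfl | hs0
  · simp
  rcases t.eq_empty_or_nonempty with rfl | ht0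
  · simp
  have hnorm : regularNorm (indicatorAlgebra s) ^ 2 ≤ d N ^ 2 * s.card := by
    rw [← twoNorm_indicatorAlgebra_sq, ← mul_pow]
    exact pow_le_pow_left₀ (norm_nonneg _) (hd N _ (by rwa [support_indicatorAlgebra])) 2
  have hpos : (0 : ℝ) < s.card * t.card := by
    have := hs0.card_pos
    have := ht0.card_pos
    positivity
  refine le_of_mul_le_mul_right ?_ hpos
  calc (s.card * t.card : ℝ) * (s.card * t.card) = s.card ^ 2 * t.card ^ 2 := by ring
    _ ≤ (s * t).card * Eₘ[s, t] := mod_cast Finset.le_card_mul_mul_mulEnergy s t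
    _ ≤ (s * t).card * (d N ^ 2 * s.card * t.card) := by
        gcongr
        exact (mulEnergy_le_regularNorm_sq_mul_card s t).trans (by gcongr)
    _ = d N ^ 2 * (s * t).card * (s.card * t.card) := by ring

end Energy

section RapidDecay

open scoped Pointwise

variable {G : Type*} [Group G] {l : G → ℝ}

lemma IsLengthFunction.map_pow_le (hl : IsLengthFunction l) (g : G) (m : ℕ) :
    l (g ^ m) ≤ m * l g := by
  induction m with
  | zero => simp [hl.map_one]
  | succ m ih =>
    rw [pow_succ]
    push_cast
    linarith [hl.map_mul_le (g ^ m) g]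

lemma IsLengthFunction.map_zpow_le (hl : IsLengthFunction l) (g : G) (m : ℤ) :
    l (g ^ m) ≤ m.natAbs * l g := by
  obtain ⟨k, rfl | rfl⟩ := m.eq_nat_or_neg
  · simpa using hl.map_pow_le g k
  · simpa [hl.map_inv] using hl.map_pow_le g k

lemma IsLengthFunction.map_prod_le (hl : IsLengthFunction l) {α A : Type*} [CommMonoid A]
    (φ : A →* G) (s : Finset α) (u : α → A) :
    l (φ (∏ i ∈ s, u i)) ≤ ∑ i ∈ s, l (φ (u i)) := by
  classical
  induction s using Finset.induction_on with
  | empty => simp [hl.map_one]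
  | insert i s hi ih =>
    rw [Finset.prod_insert hi, Finset.sum_insert hi, map_mul]
    exact (hl.map_mul_le _ _).trans (by linarith)

variable {n : ℕ+}

lemma prod_ofAdd_single_zpow (v : ZPow n) :
    ∏ i, (Multiplicative.ofAdd (Pi.single i 1) : ZPow n) ^ v.toAdd i = v := by
  apply Multiplicative.toAdd.injective
  simp only [toAdd_prod, toAdd_zpow, toAdd_ofAdd, ← Pi.single_smul', smul_eq_mul, mul_one]
  exact Finset.univ_sum_single _

lemma exists_length_le_of_mem_intBox (hl : IsLengthFunction l) (φ : ZPow n →* G) :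
    ∃ L : ℕ, ∀ k, ∀ v ∈ intBox n k, l (φ v) ≤ (L * k : ℕ) := by
  set b : Fin n → ZPow n := fun i => Multiplicative.ofAdd (Pi.single i 1)
  obtain ⟨L, hL⟩ := exists_nat_ge (∑ i, l (φ (b i)))
  refine ⟨L, fun k v hv => ?_⟩
  calc l (φ v) = l (φ (∏ i, b i ^ v.toAdd i)) := by rw [prod_ofAdd_single_zpow]
    _ ≤ ∑ i, l (φ (b i ^ v.toAdd i)) := hl.map_prod_le φ _ _
    _ ≤ ∑ i, k * l (φ (b i)) := by
        gcongr with i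
        rw [map_zpow]
        refine (hl.map_zpow_le _ _).trans ?_
        gcongr
        · exact hl.nonneg _
        · exact mem_intBox.1 hv i
    _ ≤ k * L := by rw [← Finset.mul_sum]; gcongr
    _ = (L * k : ℕ) := by push_cast; ring

lemma intBox_mul_intBox_subset (n : ℕ+) (j k : ℕ) : intBox n j * intBox n k ⊆ intBox n (j + k) := by
  refine Finset.mul_subset_iff.2 fun v hv w hw => mem_intBox.2 fun i => ?_
  exact (Int.natAbs_add_le _ _).trans (add_le_add (mem_intBox.1 hv i) (mem_intBox.1 hw i))

lemma IsDecayFunction.card_intBox_le {d : ℕ → ℝ} (hd : IsDecayFunction l d) {φ : ZPow n →* G}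
    (hφ : Function.Injective φ) {k N : ℕ} (hN : ∀ v ∈ intBox n k, l (φ v) ≤ N) :
    ((2 * k + 1) ^ (n : ℕ) : ℝ) ≤ 2 ^ (n : ℕ) * d N ^ 2 := by
  classical
  have hprod : (intBox n k).image φ * (intBox n k).image φ ⊆ (intBox n (k + k)).image φ := by
    rw [← Finset.image_mul]
    exact Finset.image_subset_image (intBox_mul_intBox_subset n k k)
  have hcard : ((2 * k + 1) ^ (n : ℕ) * (2 * k + 1) ^ (n : ℕ) : ℝ) ≤
      d N ^ 2 * ((intBox n k).image φ * (intBox n k).image φ).card := by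
    simpa [Finset.card_image_of_injective _ hφ, card_intBox] using
      hd.card_mul_card_le (s := (intBox n k).image φ) (t := (intBox n k).image φ)
        (Finset.forall_mem_image.2 hN)
  refine le_of_mul_le_mul_right (hcard.trans ?_) (by positivity : (0 : ℝ) < (2 * k + 1) ^ (n : ℕ))
  calc _ ≤ d N ^ 2 * ((2 * (k + k) + 1) ^ (n : ℕ) : ℕ) := by
        gcongr
        rw [← card_intBox, ← Finset.card_image_of_injective _ hφ]
        exact Finset.card_le_card hprod
    _ ≤ d N ^ 2 * (2 * (2 * k + 1)) ^ (n : ℕ) := by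
        push_cast
        gcongr
        linarith
    _ = 2 ^ (n : ℕ) * d N ^ 2 * (2 * k + 1) ^ (n : ℕ) := by rw [mul_pow]; ring

lemma le_natDegree_of_pow_le_eval {Q : Polynomial ℝ} {m : ℕ}
    (h : ∀ k : ℕ, (k : ℝ) ^ m ≤ Q.eval (k : ℝ)) : m ≤ Q.natDegree := by
  by_contra! hm
  have hdeg : Q.degree < ((Polynomial.X : Polynomial ℝ) ^ m).degree := by
    rw [Polynomial.degree_X_pow]
    exact Polynomial.degree_le_natDegree.trans_lt (mod_cast hm)
  have hlim := (Polynomial.div_tendsto_atTop_zero_of_degree_lt Q _ hdeg).comp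
    (tendsto_natCast_atTop_atTop (R := ℝ))
  obtain ⟨k, hk, hk0⟩ :=
    ((hlim.eventually_lt_const zero_lt_one).and (eventually_gt_atTop 0)).exists
  rw [Function.comp_apply, Polynomial.eval_pow, Polynomial.eval_X,
    div_lt_one (by positivity)] at hk
  exact (h k).not_gt hk

lemma le_two_mul_natDegree_of_injective (hl : IsLengthFunction l) {P : Polynomial ℝ}
    (hP : IsDecayFunction l fun N => P.eval (N : ℝ)) {φ : ZPow n →* G}
    (hφ : Function.Injective φ) : (n : ℕ) ≤ 2 * P.natDegree := by
  obtain ⟨L, hL⟩ := exists_length_le_of_mem_intBox hl φ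
  set Q : Polynomial ℝ :=
    .C (2 ^ (n : ℕ)) * P.comp (.C (L : ℝ) * .X) ^ 2 with hQ
  have hpow : ∀ k : ℕ, (k : ℝ) ^ (n : ℕ) ≤ Q.eval (k : ℝ) := fun k => by
    calc (k : ℝ) ^ (n : ℕ) ≤ (2 * k + 1) ^ (n : ℕ) := by gcongr; linarith
      _ ≤ Q.eval (k : ℝ) := by simpa [hQ] using hP.card_intBox_le hφ (hL k)
  calc (n : ℕ) ≤ Q.natDegree := le_natDegree_of_pow_le_eval hpow
    _ ≤ 2 * (P.comp (.C (L : ℝ) * .X)).natDegree :=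
        (Polynomial.natDegree_C_mul_le _ _).trans Polynomial.natDegree_pow_le
    _ ≤ 2 * (P.natDegree * 1) := by
        gcongr
        refine Polynomial.natDegree_comp_le.trans ?_
        gcongr
        exact (Polynomial.natDegree_C_mul_le _ _).trans Polynomial.natDegree_X_le
    _ = 2 * P.natDegree := by rw [mul_one]

theorem not_hasRD_of_injective_zPow (φ : ∀ n, ZPow n →* G)
    (hφ : ∀ n, Function.Injective (φ n)) : ¬ HasRD G := by
  rintro ⟨l, hl, P, hP⟩
  have h := le_two_mul_natDegree_of_injective hl hP (hφ ⟨2 * P.natDegree + 1, by omega⟩)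
  exact absurd h (Nat.not_succ_le_self _)

end RapidDecay

section Amenability

variable {H K : Type*} [Group H] [Group K]

lemma IsAmenable.of_surjective (hH : IsAmenable H) (φ : H →* K) (hφ : Function.Surjective φ) :
    IsAmenable K := by
  obtain ⟨m, hnonneg, huniv, hadd, hinv⟩ := hH
  refine ⟨fun A => m (φ ⁻¹' A), fun A => hnonneg _, huniv,
    fun A B hAB => hadd _ _ (hAB.preimage φ), fun k A => ?_⟩
  obtain ⟨h, rfl⟩ := hφ k
  have hpre : φ ⁻¹' ((fun x => φ h * x) '' A) = (fun x => h * x) '' (φ ⁻¹' A) := by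
    ext x
    simp [Set.image_mul_left]
  simp only [hpre, hinv]

lemma not_isAmenable_of_paradoxical {a b : H} {A A' B B' : Set H}
    (hA : A ∪ (fun x => a * x) '' A' = Set.univ) (hB : B ∪ (fun x => b * x) '' B' = Set.univ)
    (hAA' : Disjoint A A') (hBB' : Disjoint B B') (hAB : Disjoint (A ∪ A') (B ∪ B')) :
    ¬ IsAmenable H := by
  rintro ⟨m, hnonneg, huniv, hadd, hinv⟩
  have hmono : ∀ {C D : Set H}, C ⊆ D → m C ≤ m D := fun {C D} hCD => by
    have h := hadd C (D \ C) Set.disjoint_sdiff_right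
    rw [Set.union_sdiff_cancel hCD] at h
    linarith [hnonneg (D \ C)]
  have hcover : ∀ {c : H} {C C' : Set H}, C ∪ (fun x => c * x) '' C' = Set.univ →
      1 ≤ m C + m C' := fun {c C C'} hC => by
    have h := hadd C Cᶜ disjoint_compl_right
    have hcompl : m Cᶜ ≤ m ((fun x => c * x) '' C') :=
      hmono (Set.compl_subset_iff_union.2 hC)
    rw [Set.union_compl_self, huniv] at h
    rw [hinv] at hcompl
    linarith
  have htotal : m (A ∪ A' ∪ (B ∪ B')) ≤ m Set.univ := hmono (Set.subset_univ _)
  rw [hadd _ _ hAB, hadd _ _ hAA', hadd _ _ hBB', huniv] at htotal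
  linarith [hcover hA, hcover hB]

lemma startsWith_union_image_startsWith {α : Type*} [DecidableEq α] (c : α) :
    FreeGroup.startsWith (c, true) ∪
      (fun x => FreeGroup.of c * x) '' FreeGroup.startsWith (c, false) = Set.univ := by
  refine Set.eq_univ_of_forall fun g => or_iff_not_imp_right.2 fun hg => ?_
  rw [Set.image_mul_left] at hg
  rw [← mul_inv_cancel_left (FreeGroup.of c) g]
  exact FreeGroup.startsWith_mk_mul _ hg

lemma not_isAmenable_freeGroup {α : Type*} [Nontrivial α] : ¬ IsAmenable (FreeGroup α) := by
  classical
  obtain ⟨a, b, hab⟩ := exists_pair_ne α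
  have hdisj : ∀ {v w : α × Bool}, v ≠ w →
      Disjoint (FreeGroup.startsWith v) (FreeGroup.startsWith w) :=
    FreeGroup.startsWith.disjoint_iff_ne.2
  refine not_isAmenable_of_paradoxical (startsWith_union_image_startsWith a)
    (startsWith_union_image_startsWith b) (hdisj (by simp)) (hdisj (by simp)) ?_
  simp [Set.disjoint_union_left, Set.disjoint_union_right, hdisj, hab]

end Amenability

section ResiduallyFree

lemma commute_freeGroup_of_subsingleton {α : Type*} [Subsingleton α] (x y : FreeGroup α) :
    Commute x y := by
  rcases isEmpty_or_nonempty α with _ | ⟨⟨a⟩⟩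
  · exact Subsingleton.elim _ _
  · have : Unique α := uniqueOfSubsingleton a
    exact IsMulCommutative.is_comm.comm x y

lemma IsAmenable.commute_of_isFreeGroup {F : Type*} [Group F] [IsFreeGroup F]
    (hF : IsAmenable F) (x y : F) : Commute x y := by
  classical
  let e := IsFreeGroup.toFreeGroup F
  have : Subsingleton (IsFreeGroup.Generators F) := by
    by_contra h
    have : Nontrivial (IsFreeGroup.Generators F) := not_subsingleton_iff_nontrivial.1 h
    exact not_isAmenable_freeGroup (hF.of_surjective e.toMonoidHom e.surjective)
  exact (commute_freeGroup_of_subsingleton (e x) (e y)).of_map e.injective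

lemma IsAmenable.commute_of_residuallyFree {G F ι : Type*} [Group G] [Group F] [IsFreeGroup F]
    (φ : ι → G →* F) (hφ : ∀ g : G, g ≠ 1 → ∃ i, φ i g ≠ 1) {H : Subgroup G}
    (hH : IsAmenable H) {x y : G} (hx : x ∈ H) (hy : y ∈ H) : Commute x y := by
  by_contra hxy
  obtain ⟨i, hi⟩ := hφ (x * y * (y * x)⁻¹) fun h => hxy (mul_inv_eq_one.1 h)
  refine hi ?_
  rw [map_mul, map_inv, mul_inv_eq_one, map_mul, map_mul]
  have hK : IsAmenable (H.map (φ i)) :=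
    hH.of_surjective ((φ i).subgroupMap H) ((φ i).subgroupMap_surjective H)
  exact congrArg Subtype.val (hK.commute_of_isFreeGroup
    ⟨φ i x, Subgroup.mem_map_of_mem _ hx⟩ ⟨φ i y, Subgroup.mem_map_of_mem _ hy⟩).eq

lemma lift_of_comp_ne_one {ι : Type*} {G G' : ι → Type*} [∀ i, Group (G i)]
    [∀ i, Group (G' i)] [DecidableEq ι] [∀ i, DecidableEq (G i)] (χ : ∀ i, G i →* G' i)
    {g : CoprodI G} (hg : g ≠ 1) (hχ : ∀ l ∈ syllables g, χ l.1 l.2 ≠ 1) :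
    CoprodI.lift (fun i => CoprodI.of.comp (χ i)) g ≠ (1 : CoprodI G') := by
  classical
  set L := (syllables g).map fun l => (⟨l.1, χ l.1 l.2⟩ : Σ i, G' i) with hL
  have hmap : CoprodI.lift (fun i => CoprodI.of.comp (χ i)) g = listProd L := by
    conv_lhs => rw [← listProd_syllables g]
    simp [hL, listProd, map_list_prod, Function.comp_def]
  have hred : IsReducedList L :=
    ⟨List.forall_mem_map.2 hχ, by rw [hL, List.isChain_map]; exact (isReducedList_syllables g).2⟩
  rw [hmap, Ne, ← syllables_eq_nil, syllables_listProd hred, hL, List.map_eq_nil_iff,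
    syllables_eq_nil]
  exact hg

/-- The homomorphism `v ↦ ∑ vᵢ Nⁱ` from `ℤⁿ` to `ℤ`. -/
noncomputable def evalHom (N : ℕ) (n : ℕ+) : ZPow n →* Multiplicative ℤ :=
  AddMonoidHom.toMultiplicative
    ((Polynomial.leval (N : ℤ)).comp (Polynomial.ofFn (n : ℕ))).toAddMonoidHom

lemma eventually_eval_natCast_ne_zero {R : Type*} [CommRing R] [IsDomain R] [CharZero R]
    {p : Polynomial R} (hp : p ≠ 0) : ∀ᶠ N : ℕ in atTop, p.eval (N : R) ≠ 0 := by
  rw [← Nat.cofinite_eq_atTop, eventually_cofinite]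
  simpa using (Polynomial.finite_setOfPred_isRoot hp).preimage Nat.cast_injective.injOn

lemma eventually_evalHom_ne_one {n : ℕ+} {v : ZPow n} (hv : v ≠ 1) :
    ∀ᶠ N in atTop, evalHom N n v ≠ 1 := by
  have hp : Polynomial.ofFn (n : ℕ) v.toAdd ≠ 0 :=
    (map_ne_zero_iff _ (Polynomial.injective_ofFn (n : ℕ))).2 (toAdd_eq_zero.not.2 hv)
  filter_upwards [eventually_eval_natCast_ne_zero hp] with N hN using hN

lemma exists_lift_evalHom_ne_one {g : FreeProdZ} (hg : g ≠ 1) :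
    ∃ N : ℕ, CoprodI.lift (fun n => (CoprodI.of (i := n)).comp (evalHom N n)) g ≠
      (1 : CoprodI fun _ : ℕ+ => Multiplicative ℤ) := by
  have h : ∀ᶠ N in atTop, ∀ l ∈ {l | l ∈ syllables g}, evalHom N l.1 l.2 ≠ 1 :=
    (eventually_all_finite (List.finite_toSet _)).2 fun l hl =>
      eventually_evalHom_ne_one ((isReducedList_syllables g).1 l hl)
  obtain ⟨N, hN⟩ := h.exists
  exact ⟨N, lift_of_comp_ne_one _ hg hN⟩

instance isFreeGroup_multiplicative_int : IsFreeGroup (Multiplicative ℤ) :=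
  IsFreeGroup.ofMulEquiv (FreeGroup.mulEquivIntOfUnique (α := Unit))

theorem IsAmenable.commute_freeProdZ {H : Subgroup FreeProdZ} (hH : IsAmenable H)
    {x y : FreeProdZ} (hx : x ∈ H) (hy : y ∈ H) : Commute x y :=
  hH.commute_of_residuallyFree (F := CoprodI fun _ : ℕ+ => Multiplicative ℤ)
    (fun N : ℕ => CoprodI.lift fun n => (CoprodI.of (i := n)).comp (evalHom N n))
    (fun _ hg => exists_lift_evalHom_ne_one hg) hx hy

theorem hasPolynomialGrowth_of_isAmenable {H : Subgroup FreeProdZ} (hH : IsAmenable H) :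
    HasPolynomialGrowth H := by
  have hcomm : ∀ x ∈ H, ∀ y ∈ H, Commute x y := fun _ hx _ hy => hH.commute_freeProdZ hx hy
  have hfg : H.FG := fg_of_pairwise_commute (fun _ => subgroup_multiplicative_fg) hcomm
  let _ : CommGroup H :=
    { (inferInstance : Group H) with
      mul_comm := fun x y => Subtype.ext (hcomm x x.2 y y.2) }
  exact hasPolynomialGrowth_of_commGroup ((Group.fg_iff_subgroup_fg H).2 hfg)

end ResiduallyFree

lemma le_of_strictMonoOn {f : ℕ → ℕ} (hf : StrictMonoOn f (Set.Ici 1)) (hf1 : 1 ≤ f 1) {n : ℕ}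
    (hn : 1 ≤ n) : n ≤ f n := by
  induction n, hn using Nat.le_induction with
  | base => exact hf1
  | succ n hn ih => exact ih.trans_lt (hf hn (hn.trans n.le_succ) n.lt_succ_self)

end GroupDecay

theorem mainTheorem5_general (f : ℕ → ℕ) (hpos : ∀ n, 1 ≤ n → 1 ≤ f n)
    (hlim : Tendsto f atTop atTop)
    (hinv : (fun N : ℕ => (floorInverse f N : ℝ)) =o[atTop]
      fun N : ℕ => (N : ℝ) / Real.log (N : ℝ)) :
    HasSDWithRespectTo (freeProdLength f) ∧
    ¬ HasRD FreeProdZ ∧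
    ∀ H : Subgroup FreeProdZ, IsAmenable H → HasPolynomialGrowth H :=
  ⟨hasSDWithRespectTo_freeProdLength (fun n => hpos n n.2) hlim hinv,
    not_hasRD_of_injective_zPow (fun _ => Monoid.CoprodI.of) Monoid.CoprodI.of_injective,
    fun _ => hasPolynomialGrowth_of_isAmenable⟩

theorem mainTheorem5 (f : ℕ → ℕ) (hf : StrictMonoOn f (Set.Ici 1)) (hf1 : f 1 = 1)
    (hinv : (fun N : ℕ => (floorInverse f N : ℝ)) =o[atTop]
      fun N : ℕ => (N : ℝ) / Real.log (N : ℝ)) :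
    HasSDWithRespectTo (freeProdLength f) ∧
    ¬ HasRD FreeProdZ ∧
    ∀ H : Subgroup FreeProdZ, IsAmenable H → HasPolynomialGrowth H :=
  have hle : ∀ n, 1 ≤ n → n ≤ f n := fun _ => le_of_strictMonoOn hf hf1.ge
  mainTheorem5_general f (fun n hn => hn.trans (hle n hn))
    (tendsto_atTop_mono' atTop ((eventually_ge_atTop 1).mono hle) tendsto_id) hinv
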